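/- Let $1<p<\infty$, let $\mathbb T$ be the unit circle with normalized Lebesgue measure and $L^p=L^p(\mathbb T)$. Let $H^p\subset L^p$ be the Hardy space (the functions in $L^p$ whose Fourier coefficients of negative index vanish), let $K^p\subset L^p$ be the subspace of functions whose Fourier coefficients of nonnegative index vanish, and let $\mathbb P$ be the Riesz projection, i.e. the projection of $L^p$ onto $H^p$ along $K^p$. Let $\mathrm{Rat}$ be the set of rational functions with complex coefficients and $\mathrm{Rat}_0(\mathbb T)$ the set of strictly proper $\rho\in\mathrm{Rat}$ all of whose poles in $\mathbb C$ lie on $\mathbb T$ (including $\rho=0$). For $\omega\in\mathrm{Rat}$, possibly having poles on $\mathbb T$, define $T_\omega$ by $$\mathrm{Dom}(T_\omega)=\{g\in H^p : \omega g=f+\rho \text{ a.e. on } \mathbb T \text{ with } f\in L^p,\ \rho\in\mathrm{Rat}_0(\mathbb T)\},\qquad T_\omega g=\mathbb P f .$$ Then for every $\omega\in\mathrm{Rat}$: (i) $T_\omega$ is a well-defined linear operator on $H^p$: $\mathrm{Dom}(T_\omega)$ is a linear subspace of $H^p$, for $g\in\mathrm{Dom}(T_\omega)$ the value $\mathbb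 P f$ is the same for all representations $\omega g=f+\rho$ as above, and $g\mapsto T_\omega g$ is linear; (ii) $T_\omega$ is closed, and $\mathrm{Dom}(T_\omega)$ is dense in $H^p$; (iii) $\mathrm{Dom}(T_\omega)$ contains all polynomials in $z$; (iv) $\mathrm{Dom}(T_\omega)$ is invariant under the forward shift $T_z$, $(T_zg)(z)=z\,g(z)$, and for all $g\in\mathrm{Dom}(T_\omega)$ one has $T_\omega T_z g\in \mathrm{Dom}(T_{z^{-1}})$ and $T_{z^{-1}}T_\omega T_z g=T_\omega g$, where $T_{z^{-1}}$ is the operator $T_\omega$ for the symbol $\omega(z)=z^{-1}$. -/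

import Mathlib

open MeasureTheory Polynomial
open scoped ENNReal

noncomputable section

namespace ToeplitzLike

/-- Normalized Lebesgue measure on the unit circle, the circle being parametrized by
`t ↦ exp (2πi t)` with `t` in `ℝ / ℤ`. -/
abbrev μT : Measure (AddCircle (1 : ℝ)) := AddCircle.haarAddCircle

/-- The point `exp (2πi t)` of the unit circle. -/
def bdry (t : AddCircle (1 : ℝ)) : ℂ := (AddCircle.toCircle t : ℂ)

/-- The space `L^p` of the unit circle. -/
abbrev LpT (p : ℝ≥0∞) : Type := Lp ℂ p μT

theorem integrable_LpT {p : ℝ≥0∞} [Fact (1 ≤ p)] (f : LpT p) : Integrable f μT :=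
  (Lp.memLp f).integrable Fact.out

theorem fourierCoeff_add' {p : ℝ≥0∞} [Fact (1 ≤ p)] (f g : LpT p) (n : ℤ) :
    fourierCoeff (f + g : LpT p) n = fourierCoeff f n + fourierCoeff g n := by
  rw [fourierCoeff_congr_ae (Lp.coeFn_add f g)]
  exact congrFun (fourierCoeff.add (integrable_LpT f) (integrable_LpT g)) n

theorem fourierCoeff_smul' {p : ℝ≥0∞} [Fact (1 ≤ p)] (c : ℂ) (f : LpT p) (n : ℤ) :
    fourierCoeff (c • f : LpT p) n = c * fourierCoeff f n := by
  rw [fourierCoeff_congr_ae (Lp.coeFn_smul c f)]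
  exact fourierCoeff.const_mul f c n

theorem fourierCoeff_zero' {p : ℝ≥0∞} [Fact (1 ≤ p)] (n : ℤ) :
    fourierCoeff (0 : LpT p) n = 0 := by
  simpa using fourierCoeff_smul' (0 : ℂ) (0 : LpT p) n

/-- The Hardy space `H^p`, as the subspace of those elements of `L^p` of the circle whose Fourier
coefficients of negative index vanish; it carries the norm of `L^p`. -/
def Hp (p : ℝ≥0∞) [Fact (1 ≤ p)] : Submodule ℂ (LpT p) where
  carrier := {f | ∀ n : ℤ, n < 0 → fourierCoeff f n = 0}
  zero_mem' n _ := fourierCoeff_zero' n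
  add_mem' {f g} hf hg n hn := by rw [fourierCoeff_add', hf n hn, hg n hn, add_zero]
  smul_mem' c f hf n hn := by rw [fourierCoeff_smul', hf n hn, mul_zero]

/-- The standard complement `K^p` of `H^p` in `L^p`: the Fourier coefficients of nonnegative index
vanish. -/
def Kp (p : ℝ≥0∞) [Fact (1 ≤ p)] : Submodule ℂ (LpT p) where
  carrier := {f | ∀ n : ℤ, 0 ≤ n → fourierCoeff f n = 0}
  zero_mem' n _ := fourierCoeff_zero' n
  add_mem' {f g} hf hg n hn := by rw [fourierCoeff_add', hf n hn, hg n hn, add_zero]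
  smul_mem' c f hf n hn := by rw [fourierCoeff_smul', hf n hn, mul_zero]

/-- `h = ℙ f`, where `ℙ` is the Riesz projection, that is, the projection of `L^p` onto `H^p`
along `K^p`. -/
def IsRieszProj {p : ℝ≥0∞} [Fact (1 ≤ p)] (f : LpT p) (h : Hp p) : Prop := f - (h : LpT p) ∈ Kp p

/-- The value of a rational function at the point `z`, which is its true value whenever `z` is not
a pole. -/
def ratEval (ω : RatFunc ℂ) (z : ℂ) : ℂ := ω.eval (RingHom.id ℂ) z

/-- The strictly proper rational functions all of whose poles lie on the unit circle. -/
def Rat0T : Set (RatFunc ℂ) :=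
  {ρ | ρ.num.degree < ρ.denom.degree ∧ ∀ z : ℂ, ρ.denom.IsRoot z → ‖z‖ = 1}

/-- `ω g = f + ρ` with `f ∈ L^p` and `ρ` strictly proper with all its poles on the circle, as an
equality of functions almost everywhere on the circle. -/
def Decomp {p : ℝ≥0∞} [Fact (1 ≤ p)] (ω : RatFunc ℂ) (g : Hp p) (f : LpT p) (ρ : RatFunc ℂ) : Prop :=
  ρ ∈ Rat0T ∧ ∀ᵐ t ∂μT, ratEval ω (bdry t) * (g : LpT p) t = f t + ratEval ρ (bdry t)

theorem Rat0T_zero : (0 : RatFunc ℂ) ∈ Rat0T := by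
  simp [Rat0T]

theorem Rat0T_add {x y : RatFunc ℂ} (hx : x ∈ Rat0T) (hy : y ∈ Rat0T) : x + y ∈ Rat0T := by
  refine ⟨?_, fun z hz => ?_⟩
  · have h := congrArg Polynomial.degree (RatFunc.num_denom_add x y)
    have h1 : (x.num * y.denom + x.denom * y.num).degree < (x.denom * y.denom).degree := by
      refine lt_of_le_of_lt (degree_add_le _ _) (max_lt ?_ ?_)
      · rw [degree_mul, degree_mul]
        exact WithBot.add_lt_add_right (by simp [RatFunc.denom_ne_zero]) hx.1
      · rw [degree_mul, degree_mul]
        exact WithBot.add_lt_add_left (by simp [RatFunc.denom_ne_zero]) hy.1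
    rw [degree_mul, degree_mul (p := _ + _)] at h
    by_contra hc
    push Not at hc
    have h2 : (x.num * y.denom + x.denom * y.num).degree + (x + y).denom.degree
        < (x.denom * y.denom).degree + (x + y).denom.degree :=
      WithBot.add_lt_add_right (by simp [RatFunc.denom_ne_zero]) h1
    rw [← h, add_comm] at h2
    exact absurd (add_le_add_right hc _) (not_le.mpr h2)
  · have h := hz.dvd (RatFunc.denom_add_dvd x y)
    rcases root_mul.mp h with h | h
    · exact hx.2 z h
    · exact hy.2 z h

theorem Rat0T_smul (c : ℂ) {x : RatFunc ℂ} (hx : x ∈ Rat0T) : RatFunc.C c * x ∈ Rat0T := by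
  by_cases hc : c = 0
  · simpa [hc] using Rat0T_zero
  refine ⟨?_, fun z hz => ?_⟩
  · have h := congrArg Polynomial.degree (RatFunc.num_denom_mul (RatFunc.C c) x)
    simp only [RatFunc.num_C, RatFunc.denom_C, one_mul, degree_mul, degree_C hc, zero_add] at h
    by_contra hcon
    push Not at hcon
    have h2 : x.num.degree + (RatFunc.C c * x).denom.degree
        < x.denom.degree + (RatFunc.C c * x).denom.degree :=
      WithBot.add_lt_add_right (by simp [RatFunc.denom_ne_zero]) hx.1
    rw [← h, add_comm] at h2
    exact absurd (add_le_add_right hcon _) (not_le.mpr h2)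
  · have h := hz.dvd (RatFunc.denom_mul_dvd (RatFunc.C c) x)
    rw [RatFunc.denom_C, one_mul] at h
    exact hx.2 z h

theorem μT_finite {s : Set (AddCircle (1 : ℝ))} (hs : s.Finite) : μT s = 0 := by
  have : Nontrivial (AddCircle (1 : ℝ)) := by
    refine ⟨((1 / 2 : ℝ) : AddCircle (1 : ℝ)), 0, fun h => ?_⟩
    obtain ⟨n, hn⟩ := (AddCircle.coe_eq_zero_iff (1 : ℝ)).mp h
    have h2 : ((2 * n : ℤ) : ℝ) = ((1 : ℤ) : ℝ) := by
      rw [zsmul_eq_mul] at hn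
      push_cast
      linarith
    have h3 : 2 * n = 1 := by exact_mod_cast h2
    omega
  have : (nhdsWithin (0 : AddCircle (1 : ℝ)) {0}ᶜ).NeBot := inferInstance
  have : NullSingletonClass μT := Measure.IsAddHaarMeasure.nullSingletonClass μT
  exact hs.measure_zero μT

/-- Almost no point of the circle is a pole of a given rational function. -/
theorem ae_denom_ne (x : RatFunc ℂ) :
    ∀ᵐ t ∂μT, x.denom.eval₂ (RingHom.id ℂ) (bdry t) ≠ 0 := by
  have hinj : Function.Injective bdry := fun s t h =>
    AddCircle.injective_toCircle (by norm_num) (Subtype.ext h)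
  have hfin : {t | x.denom.eval₂ (RingHom.id ℂ) (bdry t) = 0}.Finite := by
    refine Set.Finite.subset
      ((x.denom.roots.toFinset.finite_toSet).preimage hinj.injOn) fun t ht => ?_
    simpa [RatFunc.denom_ne_zero, Polynomial.eval₂_id] using ht
  rw [ae_iff]
  simpa only [ne_eq, not_not] using μT_finite hfin

theorem Decomp.add {p : ℝ≥0∞} [Fact (1 ≤ p)] {ω : RatFunc ℂ} {g g' : Hp p} {f f' : LpT p} {ρ ρ' : RatFunc ℂ}
    (h : Decomp ω g f ρ) (h' : Decomp ω g' f' ρ') : Decomp ω (g + g') (f + f') (ρ + ρ') := by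
  refine ⟨Rat0T_add h.1 h'.1, ?_⟩
  filter_upwards [h.2, h'.2, ae_denom_ne ρ, ae_denom_ne ρ', Lp.coeFn_add f f',
    Lp.coeFn_add (g : LpT p) (g' : LpT p)] with t h1 h2 h3 h4 h5 h6
  have h7 : ratEval (ρ + ρ') (bdry t) = ratEval ρ (bdry t) + ratEval ρ' (bdry t) :=
    RatFunc.eval_add _ _ h3 h4
  rw [h7, Submodule.coe_add, h5, h6, Pi.add_apply, Pi.add_apply, mul_add, h1, h2]
  ring

theorem Decomp.smul {p : ℝ≥0∞} [Fact (1 ≤ p)] (c : ℂ) {ω : RatFunc ℂ} {g : Hp p} {f : LpT p} {ρ : RatFunc ℂ}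
    (h : Decomp ω g f ρ) : Decomp ω (c • g) (c • f) (RatFunc.C c * ρ) := by
  refine ⟨Rat0T_smul c h.1, ?_⟩
  filter_upwards [h.2, ae_denom_ne ρ, Lp.coeFn_smul c f,
    Lp.coeFn_smul c (g : LpT p)] with t h1 h3 h5 h6
  have h7 : ratEval (RatFunc.C c * ρ) (bdry t) = c * ratEval ρ (bdry t) := by
    unfold ratEval
    rw [RatFunc.eval_mul _ _ (by simp) h3, RatFunc.eval_C, RingHom.id_apply]
  rw [h7, Submodule.coe_smul, h5, h6, Pi.smul_apply, Pi.smul_apply, smul_eq_mul, smul_eq_mul,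
    mul_left_comm, h1]
  ring

theorem Decomp.zero {p : ℝ≥0∞} [Fact (1 ≤ p)] (ω : RatFunc ℂ) : Decomp ω (0 : Hp p) 0 0 := by
  refine ⟨Rat0T_zero, ?_⟩
  exact Filter.Eventually.of_forall fun t => by simp [ratEval]

/-- The graph of the Toeplitz-like operator `T_ω`: the pairs `(g, ℙ f)` in `H^p × H^p` with
`ω g = f + ρ` for some `ρ` strictly proper with all its poles on the circle. -/
def toeplitzGraph (p : ℝ≥0∞) [Fact (1 ≤ p)] (ω : RatFunc ℂ) : Submodule ℂ (Hp p × Hp p) where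
  carrier := {x | ∃ (f : LpT p) (ρ : RatFunc ℂ), Decomp ω x.1 f ρ ∧ IsRieszProj f x.2}
  zero_mem' := ⟨0, 0, Decomp.zero ω, by simp [IsRieszProj]⟩
  add_mem' := by
    rintro ⟨g, h⟩ ⟨g', h'⟩ ⟨f, ρ, hd, hr⟩ ⟨f', ρ', hd', hr'⟩
    refine ⟨f + f', ρ + ρ', hd.add hd', ?_⟩
    have := (Kp p).add_mem hr hr'
    rwa [← add_sub_add_comm] at this
  smul_mem' := by
    rintro c ⟨g, h⟩ ⟨f, ρ, hd, hr⟩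
    refine ⟨c • f, RatFunc.C c * ρ, hd.smul c, ?_⟩
    have := (Kp p).smul_mem c hr
    rwa [smul_sub] at this

/-- The Toeplitz-like operator `T_ω`, an unbounded operator on `H^p`. (That its graph really is the
graph of a map is part of what is to be proved about it.) -/
def toeplitz (p : ℝ≥0∞) [Fact (1 ≤ p)] (ω : RatFunc ℂ) : Hp p →ₗ.[ℂ] Hp p :=
  (toeplitzGraph p ω).toLinearPMap

theorem bdry_mul_memLp {p : ℝ≥0∞} (f : LpT p) : MemLp (fun t => bdry t * f t) p μT := by
  have hb : Continuous bdry := continuous_subtype_val.comp AddCircle.continuous_toCircle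
  refine (Lp.memLp f).of_le (hb.aestronglyMeasurable.mul (Lp.aestronglyMeasurable f)) ?_
  exact Filter.Eventually.of_forall fun t => by
    rw [norm_mul, bdry, Circle.norm_coe, one_mul]

theorem bdry_mul_mem_Hp {p : ℝ≥0∞} [Fact (1 ≤ p)] (g : Hp p) : (bdry_mul_memLp (g : LpT p)).toLp ∈ Hp p := by
  show ∀ n : ℤ, n < 0 → fourierCoeff _ n = 0
  intro n hn
  rw [fourierCoeff_congr_ae (MemLp.coeFn_toLp _), ← g.2 (n - 1) (by omega)]
  unfold fourierCoeff
  refine integral_congr_ae (Filter.Eventually.of_forall fun t => ?_)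
  have h : fourier (-(n - 1)) t = fourier (-n) t * bdry t := by
    rw [show -(n - 1) = -n + 1 by ring, fourier_add, fourier_one, bdry]
  simp only [smul_eq_mul, h, mul_assoc]

/-- The forward shift `T_z` on `H^p`, `(T_z g)(z) = z g(z)`. -/
def shift (p : ℝ≥0∞) [Fact (1 ≤ p)] : Hp p →ₗ[ℂ] Hp p where
  toFun g := ⟨(bdry_mul_memLp (g : LpT p)).toLp, bdry_mul_mem_Hp g⟩
  map_add' g h := by
    refine Subtype.ext (Lp.ext ?_)
    filter_upwards [MemLp.coeFn_toLp (bdry_mul_memLp ((g + h : Hp p) : LpT p)),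
      MemLp.coeFn_toLp (bdry_mul_memLp (g : LpT p)),
      MemLp.coeFn_toLp (bdry_mul_memLp (h : LpT p)),
      Lp.coeFn_add (g : LpT p) (h : LpT p),
      Lp.coeFn_add (bdry_mul_memLp (g : LpT p)).toLp (bdry_mul_memLp (h : LpT p)).toLp]
      with t h1 h2 h3 h4 h5
    rw [h1]
    refine Eq.trans ?_ h5.symm
    rw [Submodule.coe_add, Pi.add_apply, h2, h3, h4, Pi.add_apply, mul_add]
  map_smul' c g := by
    refine Subtype.ext (Lp.ext ?_)
    filter_upwards [MemLp.coeFn_toLp (bdry_mul_memLp ((c • g : Hp p) : LpT p)),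
      MemLp.coeFn_toLp (bdry_mul_memLp (g : LpT p)),
      Lp.coeFn_smul c (g : LpT p),
      Lp.coeFn_smul c (bdry_mul_memLp (g : LpT p)).toLp]
      with t h1 h2 h4 h5
    rw [h1]
    refine Eq.trans ?_ h5.symm
    rw [Submodule.coe_smul, Pi.smul_apply, h2, h4, Pi.smul_apply, smul_eq_mul, smul_eq_mul, mul_left_comm]

end ToeplitzLike

end

open ToeplitzLike

noncomputable section

namespace ToeplitzLike

open Filter Topology

/-! Write `ω = s/(de)` in lowest terms, with `d`, `e` monic, the zeros of `d` outside the closed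
disc and those of `e` in it. If `ωg = h + k + ρ` with `k ∈ K^p` and `ρ = r/b` in `Rat0T`, then `w =
(s/d)g - eh` equals `e(k + ρ)`. The function `dw` has no negative Fourier coefficients, and those of
`bw = e(bk + r)` vanish from `deg b + deg e` on; dividing out `d` and `b` shows that `w` is a
polynomial of degree below `deg e`. Conversely, partial fractions of `w/e`, separating zeros in the
open disc from zeros on the circle, recover `k` and `ρ`. So `(g, h)` lies in the graph exactly when
the coefficients of `w` vanish from `deg e` on (`DenomFactorization.mem_graph_iff`).

These conditions are linear and continuous in `(g, h)`, whence closedness. For `g = 0` they give `h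
∈ K^p ∩ H^p = 0`; for polynomial `g`, division with remainder yields `h`. Replacing `(g, h)` by
`(zg, zh + c)` turns `w` into `zw - ce`, so a suitable `c` gives `T_ω T_z g = z T_ω g + c`, which
`T_{z⁻¹}` sends back to `T_ω g`.

Two analytic tools are used. Division by polynomials rests on a first-order recursion for the
coefficients and the Riemann–Lebesgue lemma. The theorem of M. Riesz (`rieszBound`) shows that every
`f ∈ L^p` has a projection and that polynomials are dense in `H^p`; it is proved by Calderón's
inequality for `p ≤ 2` and Cotlar's passage from `p` to `2p`. -/

/-! ### Multiplication by continuous functions and polynomials, and its effect on Fourier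
coefficients. -/

theorem continuous_bdry : Continuous bdry :=
  continuous_subtype_val.comp AddCircle.continuous_toCircle

theorem norm_bdry (t : AddCircle (1 : ℝ)) : ‖bdry t‖ = 1 := Circle.norm_coe _

theorem continuous_eval_bdry (Q : ℂ[X]) : Continuous fun t => Q.eval (bdry t) :=
  Q.continuous.comp continuous_bdry

theorem fourier_one_eq_bdry (t : AddCircle (1 : ℝ)) : fourier 1 t = bdry t := fourier_one

theorem exists_norm_bound {c : AddCircle (1 : ℝ) → ℂ} (hc : Continuous c) :
    ∃ C : ℝ, ∀ t, ‖c t‖ ≤ C := by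
  obtain ⟨C, hC⟩ := isCompact_univ.exists_bound_of_continuousOn hc.continuousOn
  exact ⟨C, fun t => hC t trivial⟩

theorem memLp_mul_continuous {p : ℝ≥0∞} {c φ : AddCircle (1 : ℝ) → ℂ} (hc : Continuous c)
    (hφ : MemLp φ p μT) : MemLp (fun t => c t * φ t) p μT := by
  obtain ⟨C, hC⟩ := exists_norm_bound hc
  refine MemLp.of_le_mul (c := C) hφ (hc.aestronglyMeasurable.mul hφ.1) ?_
  exact Eventually.of_forall fun t => by
    rw [norm_mul]
    exact mul_le_mul_of_nonneg_right (hC t) (norm_nonneg _)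

theorem memLp_continuous {p : ℝ≥0∞} {c : AddCircle (1 : ℝ) → ℂ} (hc : Continuous c) :
    MemLp c p μT := by
  obtain ⟨C, hC⟩ := exists_norm_bound hc
  exact MemLp.of_bound hc.aestronglyMeasurable C (Eventually.of_forall hC)

theorem integrable_mul_continuous {c φ : AddCircle (1 : ℝ) → ℂ} (hc : Continuous c)
    (hφ : Integrable φ μT) : Integrable (fun t => c t * φ t) μT :=
  memLp_one_iff_integrable.1 (memLp_mul_continuous hc (memLp_one_iff_integrable.2 hφ))

theorem fourierCoeff_sub {φ ψ : AddCircle (1 : ℝ) → ℂ} (hφ : Integrable φ μT)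
    (hψ : Integrable ψ μT) (n : ℤ) :
    fourierCoeff (fun t => φ t - ψ t) n = fourierCoeff φ n - fourierCoeff ψ n := by
  have h := congrFun (fourierCoeff.add hφ (hψ.const_mul (-1))) n
  rw [Pi.add_apply, fourierCoeff.const_mul] at h
  rw [sub_eq_add_neg, ← neg_one_mul, ← h]
  congr 1
  ext t
  simp [sub_eq_add_neg]

theorem fourierCoeff_pow_bdry_mul (φ : AddCircle (1 : ℝ) → ℂ) (i : ℕ) (n : ℤ) :
    fourierCoeff (fun t => bdry t ^ i * φ t) n = fourierCoeff φ (n - i) := by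
  unfold fourierCoeff
  refine integral_congr_ae (Eventually.of_forall fun t => ?_)
  have h : fourier (-(n - i)) t = fourier (-n) t * bdry t ^ i := by
    rw [show -(n - i : ℤ) = -n + i by ring, fourier_add]
    simp [bdry, AddCircle.toCircle_nsmul]
  simp only [smul_eq_mul, h, mul_assoc]

theorem fourierCoeff_bdry_mul (φ : AddCircle (1 : ℝ) → ℂ) (n : ℤ) :
    fourierCoeff (fun t => bdry t * φ t) n = fourierCoeff φ (n - 1) := by
  simpa using fourierCoeff_pow_bdry_mul φ 1 n

theorem fourierCoeff_eval_mul (Q : ℂ[X]) {φ : AddCircle (1 : ℝ) → ℂ} (hφ : Integrable φ μT)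
    (n : ℤ) : fourierCoeff (fun t => Q.eval (bdry t) * φ t) n =
      Q.sum fun i a => a * fourierCoeff φ (n - i) := by
  have h : (fun t => Q.eval (bdry t) * φ t) =
      ∑ i ∈ Q.support, fun t => Q.coeff i * (bdry t ^ i * φ t) := by
    ext t
    rw [eval_eq_sum, Polynomial.sum, Finset.sum_mul, Finset.sum_apply]
    exact Finset.sum_congr rfl fun i _ => mul_assoc _ _ _
  rw [h, fourierCoeff.sum, Finset.sum_apply, Polynomial.sum]
  · refine Finset.sum_congr rfl fun i _ => ?_
    rw [fourierCoeff.const_mul, fourierCoeff_pow_bdry_mul]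
  · intro i _
    exact (integrable_mul_continuous (continuous_bdry.pow i) hφ).const_mul _

theorem fourierCoeff_one (n : ℤ) :
    fourierCoeff (fun _ : AddCircle (1 : ℝ) => (1 : ℂ)) n = if n = 0 then 1 else 0 := by
  have h := congrFun (fourierCoeff_fourier (T := 1) 0) n
  rw [Pi.single_apply] at h
  rw [← h]
  congr 1
  ext t
  simp

theorem fourierCoeff_eval (Q : ℂ[X]) (n : ℤ) :
    fourierCoeff (fun t => Q.eval (bdry t)) n = if 0 ≤ n then Q.coeff n.toNat else 0 := by
  have h := fourierCoeff_eval_mul Q (φ := fun _ => 1) (integrable_const _) n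
  simp only [mul_one] at h
  rw [h]
  simp only [fourierCoeff_one, Polynomial.sum, mul_ite, mul_one, mul_zero]
  split_ifs with hn
  · rw [Finset.sum_eq_single n.toNat]
    · rw [if_pos (by omega)]
    · intro i _ hi
      rw [if_neg (by omega)]
    · intro h
      rw [if_pos (by omega)]
      simpa using h
  · exact Finset.sum_eq_zero fun i _ => if_neg (by omega)

theorem fourierCoeff_eval_of_degree_lt {Q : ℂ[X]} {m : ℕ} (hQ : Q.degree < m) {n : ℤ}
    (hn : (m : ℤ) ≤ n) : fourierCoeff (fun t => Q.eval (bdry t)) n = 0 := by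
  rw [fourierCoeff_eval, if_pos (by omega)]
  refine coeff_eq_zero_of_degree_lt (hQ.trans_le ?_)
  exact_mod_cast (by omega : m ≤ n.toNat)

theorem fourierCoeff_eval_mul_of_lt {Q : ℂ[X]} {φ : AddCircle (1 : ℝ) → ℂ}
    (hφ : Integrable φ μT) {m : ℤ} (h : ∀ j < m, fourierCoeff φ j = 0) {j : ℤ} (hj : j < m) :
    fourierCoeff (fun t => Q.eval (bdry t) * φ t) j = 0 := by
  rw [fourierCoeff_eval_mul Q hφ]
  exact Finset.sum_eq_zero fun i _ => by simp only [h (j - i) (by omega), mul_zero]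

theorem fourierCoeff_eval_mul_of_ge {Q : ℂ[X]} {φ : AddCircle (1 : ℝ) → ℂ}
    (hφ : Integrable φ μT) {m : ℤ} (h : ∀ j, m ≤ j → fourierCoeff φ j = 0) {j : ℤ}
    (hj : m + Q.natDegree ≤ j) :
    fourierCoeff (fun t => Q.eval (bdry t) * φ t) j = 0 := by
  rw [fourierCoeff_eval_mul Q hφ]
  refine Finset.sum_eq_zero fun i hi => ?_
  have := le_natDegree_of_mem_supp i hi
  simp only [h (j - i) (by omega), mul_zero]

/-! ### Riemann–Lebesgue and division by polynomials. -/

/-- The Riemann–Lebesgue lemma on the circle. -/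
theorem tendsto_fourierCoeff_cofinite (φ : AddCircle (1 : ℝ) → ℂ) :
    Tendsto (fourierCoeff φ) cofinite (𝓝 0) := by
  -- The lemma on the line, for `φ` cut off to one period, is restricted to integer frequencies.
  have h := (Real.tendsto_integral_exp_smul_cocompact
    ((Set.Ioc (0 : ℝ) 1).indicator fun x => φ x)).comp Int.tendsto_coe_cofinite
  refine h.congr fun n => ?_
  rw [fourierCoeff_eq_intervalIntegral φ n 0, intervalIntegral.integral_of_le (by norm_num),
    ← integral_indicator measurableSet_Ioc, zero_add]
  simp only [Function.comp_apply, div_one, one_smul]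
  refine integral_congr_ae (Eventually.of_forall fun x => ?_)
  by_cases hx : x ∈ Set.Ioc (0 : ℝ) 1
  · simp only [Set.indicator_of_mem hx]
    rw [fourier_coe_apply, Circle.smul_def, Real.fourierChar_apply]
    congr 2
    push_cast
    ring
  · simp only [Set.indicator_of_notMem hx, smul_zero]

theorem tendsto_norm_fourierCoeff (φ : AddCircle (1 : ℝ) → ℂ) {u : ℕ → ℤ}
    (hu : Function.Injective u) : Tendsto (fun k => ‖fourierCoeff φ (u k)‖) atTop (𝓝 0) := by
  have h := ((tendsto_fourierCoeff_cofinite φ).comp hu.tendsto_cofinite).norm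
  rwa [norm_zero, Nat.cofinite_eq_atTop] at h

theorem fourierCoeff_sub_mul {φ : AddCircle (1 : ℝ) → ℂ} (hφ : Integrable φ μT) (α : ℂ) (n : ℤ) :
    fourierCoeff (fun t => (bdry t - α) * φ t) n =
      fourierCoeff φ (n - 1) - α * fourierCoeff φ n := by
  rw [← fourierCoeff_bdry_mul, ← fourierCoeff.const_mul,
    ← fourierCoeff_sub (integrable_mul_continuous continuous_bdry hφ) (hφ.const_mul α)]
  congr 1
  ext t
  ring

/-- The hypothesis reads `φ̂(n-1) = α φ̂(n)` for `n > m`. As `‖α‖ ≤ 1`, the moduli increase with the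
index from `m` on, yet they tend to zero. -/
theorem fourierCoeff_eq_zero_of_ge_of_sub_mul {φ : AddCircle (1 : ℝ) → ℂ} (hφ : Integrable φ μT)
    {α : ℂ} (hα : ‖α‖ ≤ 1) {m : ℤ}
    (h : ∀ j, m + 1 ≤ j → fourierCoeff (fun t => (bdry t - α) * φ t) j = 0) {j : ℤ}
    (hj : m ≤ j) : fourierCoeff φ j = 0 := by
  have hmono : Monotone fun k : ℕ => ‖fourierCoeff φ (j + k)‖ := by
    refine monotone_nat_of_le_succ fun k => ?_
    have h1 := h (j + k + 1) (by omega)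
    rw [fourierCoeff_sub_mul hφ, add_sub_cancel_right, sub_eq_zero] at h1
    rw [h1, norm_mul, Nat.cast_succ, ← add_assoc]
    exact mul_le_of_le_one_left (norm_nonneg _) hα
  have h0 := hmono.ge_of_tendsto
    (tendsto_norm_fourierCoeff φ (u := fun k : ℕ => j + k) fun a b hab => by simpa using hab) 0
  simpa using h0

/-- The same recursion, run towards `-∞`. Zeros on the circle itself are allowed in both versions.
-/
theorem fourierCoeff_eq_zero_of_lt_of_sub_mul {φ : AddCircle (1 : ℝ) → ℂ} (hφ : Integrable φ μT)
    {α : ℂ} (hα : 1 ≤ ‖α‖) {m : ℤ}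
    (h : ∀ j < m, fourierCoeff (fun t => (bdry t - α) * φ t) j = 0) {j : ℤ}
    (hj : j < m) : fourierCoeff φ j = 0 := by
  have hmono : Monotone fun k : ℕ => ‖fourierCoeff φ (j - k)‖ := by
    refine monotone_nat_of_le_succ fun k => ?_
    have h1 := h (j - k) (by omega)
    rw [fourierCoeff_sub_mul hφ, sub_eq_zero] at h1
    rw [Nat.cast_succ, ← sub_sub, h1, norm_mul]
    exact le_mul_of_one_le_left (norm_nonneg _) hα
  have h0 := hmono.ge_of_tendsto
    (tendsto_norm_fourierCoeff φ (u := fun k : ℕ => j - k) fun a b hab => by simpa using hab) 0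
  simpa using h0

theorem monic_eq_prod_roots {Q : ℂ[X]} (hQ : Q.Monic) :
    Q = (Q.roots.map fun a => X - C a).prod :=
  ((IsAlgClosed.splits Q).eq_prod_roots_of_monic hQ)

theorem card_roots_complex (Q : ℂ[X]) : Q.roots.card = Q.natDegree :=
  (IsAlgClosed.splits Q).natDegree_eq_card_roots.symm

/-- Dividing by a polynomial with zeros in the closed disc. -/
theorem fourierCoeff_eq_zero_of_ge_of_eval_mul {Q : ℂ[X]} (hQ : Q.Monic)
    (hr : ∀ a ∈ Q.roots, ‖a‖ ≤ 1) {φ : AddCircle (1 : ℝ) → ℂ} (hφ : Integrable φ μT) {m : ℤ}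
    (h : ∀ j, m + Q.natDegree ≤ j → fourierCoeff (fun t => Q.eval (bdry t) * φ t) j = 0) :
    ∀ j, m ≤ j → fourierCoeff φ j = 0 := by
  rw [← card_roots_complex, monic_eq_prod_roots hQ, roots_multiset_prod_X_sub_C] at h
  -- Now `Q` enters only through its roots; the induction removes one linear factor at a time, each
  -- lowering the threshold by one.
  generalize Q.roots = s at h hr
  induction s using Multiset.induction generalizing m with
  | empty => simpa using h
  | cons a s ih =>
    refine ih (fun j hj => ?_) fun b hb => hr b (Multiset.mem_cons_of_mem hb)
    refine fourierCoeff_eq_zero_of_ge_of_sub_mul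
      (integrable_mul_continuous (continuous_eval_bdry _) hφ)
      (hr a (Multiset.mem_cons_self a s)) (fun i hi => ?_) hj
    refine Eq.trans ?_ (h i (by rw [Multiset.card_cons]; push_cast; omega))
    simp [mul_assoc]

/-- Dividing by a polynomial without zeros in the open disc. -/
theorem fourierCoeff_eq_zero_of_lt_of_eval_mul {Q : ℂ[X]} (hQ : Q.Monic)
    (hr : ∀ a ∈ Q.roots, 1 ≤ ‖a‖) {φ : AddCircle (1 : ℝ) → ℂ} (hφ : Integrable φ μT) {m : ℤ}
    (h : ∀ j < m, fourierCoeff (fun t => Q.eval (bdry t) * φ t) j = 0) :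
    ∀ j < m, fourierCoeff φ j = 0 := by
  rw [monic_eq_prod_roots hQ] at h
  generalize Q.roots = s at h hr
  induction s using Multiset.induction generalizing m with
  | empty => simpa using h
  | cons a s ih =>
    refine ih (fun j hj => ?_) fun b hb => hr b (Multiset.mem_cons_of_mem hb)
    refine fourierCoeff_eq_zero_of_lt_of_sub_mul
      (integrable_mul_continuous (continuous_eval_bdry _) hφ)
      (hr a (Multiset.mem_cons_self a s)) (fun i hi => ?_) hj
    refine Eq.trans ?_ (h i hi)
    simp [mul_assoc]

/-! ### Continuity and uniqueness of Fourier coefficients. -/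

/-- The pairing with a continuous function, as a continuous functional on `L^p`. -/
def pairing (p : ℝ≥0∞) [Fact (1 ≤ p)] (ψ : C(AddCircle (1 : ℝ), ℂ)) : LpT p →L[ℂ] ℂ :=
  LinearMap.mkContinuous
    { toFun := fun f => ∫ t, ψ t * f t ∂μT
      map_add' := fun f g => by
        rw [← integral_add (integrable_mul_continuous ψ.continuous (integrable_LpT f))
          (integrable_mul_continuous ψ.continuous (integrable_LpT g))]
        refine integral_congr_ae ?_
        filter_upwards [Lp.coeFn_add f g] with t ht
        rw [ht, Pi.add_apply, mul_add]
      map_smul' := fun c f => by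
        rw [RingHom.id_apply, smul_eq_mul, ← integral_const_mul]
        refine integral_congr_ae ?_
        filter_upwards [Lp.coeFn_smul c f] with t ht
        rw [ht, Pi.smul_apply, smul_eq_mul, mul_left_comm] }
    ‖ψ‖ fun f => by
      have h1 : ∫ t, ‖f t‖ ∂μT ≤ ‖f‖ := by
        rw [integral_norm_eq_lintegral_enorm (Lp.aestronglyMeasurable f),
          ← eLpNorm_one_eq_lintegral_enorm, Lp.norm_def]
        exact ENNReal.toReal_mono (Lp.eLpNorm_ne_top f)
          (eLpNorm_le_eLpNorm_of_exponent_le Fact.out (Lp.aestronglyMeasurable f))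
      refine (norm_integral_le_of_norm_le ((integrable_LpT f).norm.const_mul ‖ψ‖)
        (Eventually.of_forall fun t => ?_)).trans ?_
      · rw [norm_mul]
        exact mul_le_mul_of_nonneg_right (ψ.norm_coe_le_norm t) (norm_nonneg _)
      · rw [integral_const_mul]
        exact mul_le_mul_of_nonneg_left h1 (norm_nonneg _)

theorem pairing_apply {p : ℝ≥0∞} [Fact (1 ≤ p)] (ψ : C(AddCircle (1 : ℝ), ℂ)) (f : LpT p) :
    pairing p ψ f = ∫ t, ψ t * f t ∂μT := rfl

theorem pairing_fourier {p : ℝ≥0∞} [Fact (1 ≤ p)] (n : ℤ) (f : LpT p) :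
    pairing p (fourier (-n)) f = fourierCoeff f n := rfl

theorem norm_fourierCoeff_le {p : ℝ≥0∞} [Fact (1 ≤ p)] (f : LpT p) (n : ℤ) :
    ‖fourierCoeff f n‖ ≤ ‖f‖ := by
  have h := (pairing p (fourier (-n))).le_of_opNorm_le
    (LinearMap.mkContinuous_norm_le _ (norm_nonneg _) _) f
  rwa [pairing_fourier, fourier_norm, one_mul] at h

theorem isClosed_Hp (p : ℝ≥0∞) [Fact (1 ≤ p)] : IsClosed (Hp p : Set (LpT p)) := by
  have h : (Hp p : Set (LpT p)) = ⋂ n : ℤ, ⋂ _ : n < 0, {f | pairing p (fourier (-n)) f = 0} := by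
    ext f
    simp only [Set.mem_iInter, Set.mem_ofPred_eq, pairing_fourier]
    rfl
  rw [h]
  exact isClosed_iInter fun n => isClosed_iInter fun _ =>
    isClosed_eq (pairing p _).continuous continuous_const

theorem isClosed_Kp (p : ℝ≥0∞) [Fact (1 ≤ p)] : IsClosed (Kp p : Set (LpT p)) := by
  have h : (Kp p : Set (LpT p)) = ⋂ n : ℤ, ⋂ _ : 0 ≤ n, {f | pairing p (fourier (-n)) f = 0} := by
    ext f
    simp only [Set.mem_iInter, Set.mem_ofPred_eq, pairing_fourier]
    rfl
  rw [h]
  exact isClosed_iInter fun n => isClosed_iInter fun _ =>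
    isClosed_eq (pairing p _).continuous continuous_const

/-- An element of `L^p` is determined by its Fourier coefficients. -/
theorem eq_zero_of_fourierCoeff_eq_zero {p : ℝ≥0∞} [Fact (1 ≤ p)] (hp : 1 < p) {f : LpT p}
    (h : ∀ n, fourierCoeff f n = 0) : f = 0 := by
  set q := p.conjExponent with hq
  have hpq : p.HolderConjugate q := ENNReal.HolderConjugate.conjExponent hp.le
  have hq1 : Fact (1 ≤ q) := ⟨hpq.symm.one_le⟩
  -- Since `p > 1`, the conjugate exponent is finite, so the exponentials span a dense subspace of
  -- `L^q`.
  have hqt : q ≠ ∞ := by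
    intro h
    have := (ENNReal.HolderConjugate.eq_top_iff_eq_one q p).1 h
    exact hp.ne' this
  let L : LpT q →L[ℂ] ℂ :=
    ContinuousLinearMap.lpPairing μT p q (ContinuousLinearMap.mul ℂ ℂ) f
  have hL : ∀ g : LpT q, L g = ∫ t, f t * g t ∂μT := fun g =>
    ContinuousLinearMap.lpPairing_eq_integral _ f g
  have hker : LinearMap.ker (L : LpT q →ₗ[ℂ] ℂ) = ⊤ := by
    rw [eq_top_iff, ← span_fourierLp_closure_eq_top hqt]
    refine Submodule.topologicalClosure_minimal _ (Submodule.span_le.2 ?_) L.isClosed_ker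
    rintro _ ⟨n, rfl⟩
    show L (fourierLp q n) = 0
    rw [hL, ← h (-n)]
    refine integral_congr_ae ?_
    filter_upwards [coeFn_fourierLp (T := 1) q n] with t ht
    rw [ht, neg_neg, smul_eq_mul, mul_comm]
  have hz : (f : AddCircle (1 : ℝ) → ℂ) =ᵐ[μT] 0 := by
    refine (integrable_LpT f).ae_eq_zero_of_forall_setIntegral_eq_zero fun s hs _ => ?_
    have h1 : L (indicatorConstLp q hs (measure_ne_top μT s) (1 : ℂ)) = 0 := by
      have : indicatorConstLp q hs (measure_ne_top μT s) (1 : ℂ) ∈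
        LinearMap.ker (L : LpT q →ₗ[ℂ] ℂ) := hker ▸ Submodule.mem_top
      exact this
    rw [hL] at h1
    rw [← integral_indicator hs, ← h1]
    refine integral_congr_ae ?_
    filter_upwards [indicatorConstLp_coeFn (p := q) (hs := hs) (hμs := measure_ne_top μT s)
      (c := (1 : ℂ))] with t ht
    rw [ht]
    by_cases hts : t ∈ s <;> simp [hts]
  exact Lp.ext (hz.trans (Lp.coeFn_zero _ _ _).symm)

theorem ae_eq_zero_of_fourierCoeff_eq_zero {p : ℝ≥0∞} [Fact (1 ≤ p)] (hp : 1 < p)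
    {φ : AddCircle (1 : ℝ) → ℂ} (hφ : MemLp φ p μT) (h : ∀ n, fourierCoeff φ n = 0) :
    φ =ᵐ[μT] 0 := by
  have h0 : hφ.toLp = 0 := eq_zero_of_fourierCoeff_eq_zero hp fun n => by
    rw [fourierCoeff_congr_ae hφ.coeFn_toLp, h]
  have h1 := hφ.coeFn_toLp
  rw [h0] at h1
  exact h1.symm.trans (Lp.coeFn_zero _ _ _)

theorem eq_zero_of_mem_Hp_of_mem_Kp {p : ℝ≥0∞} [Fact (1 ≤ p)] (hp : 1 < p) {f : LpT p}
    (hH : f ∈ Hp p) (hK : f ∈ Kp p) : f = 0 :=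
  eq_zero_of_fourierCoeff_eq_zero hp fun n => (lt_or_ge n 0).elim (hH n) (hK n)

/-- A function whose Fourier coefficients are supported in `[0, m)` is a polynomial. -/
theorem exists_polynomial_of_fourierCoeff {p : ℝ≥0∞} [Fact (1 ≤ p)] (hp : 1 < p)
    {φ : AddCircle (1 : ℝ) → ℂ} (hφ : MemLp φ p μT) {m : ℕ} (h0 : ∀ j < 0, fourierCoeff φ j = 0)
    (h1 : ∀ j : ℤ, m ≤ j → fourierCoeff φ j = 0) :
    ∃ v : ℂ[X], v.degree < m ∧ φ =ᵐ[μT] fun t => v.eval (bdry t) := by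
  let v : ℂ[X] := ∑ i ∈ Finset.range m, monomial i (fourierCoeff φ i)
  have hv : ∀ i, v.coeff i = fourierCoeff φ i := by
    intro i
    simp only [v, finsetSum_coeff, coeff_monomial]
    rw [Finset.sum_ite_eq' (Finset.range m) i]
    split_ifs with hi
    · rfl
    · rw [h1 i (by simpa using hi)]
  refine ⟨v, ?_, ?_⟩
  · rw [degree_lt_iff_coeff_zero]
    intro i hi
    rw [hv, h1 i (by exact_mod_cast hi)]
  · have hvL : MemLp (fun t => v.eval (bdry t)) p μT := memLp_continuous (continuous_eval_bdry v)
    have := ae_eq_zero_of_fourierCoeff_eq_zero hp (hφ.sub hvL) fun n => by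
      rw [show φ - (fun t => v.eval (bdry t)) = fun t => φ t - v.eval (bdry t) from rfl,
        fourierCoeff_sub (hφ.integrable Fact.out) (hvL.integrable Fact.out), fourierCoeff_eval]
      split_ifs with hn
      · rw [hv, Int.toNat_of_nonneg hn, sub_self]
      · rw [h0 n (by omega), sub_zero]
    filter_upwards [this] with t ht
    simpa [sub_eq_zero] using ht

/-! ### Trigonometric polynomials and their norms. -/

open ComplexConjugate

/-- The class in `L^p` of a continuous function. -/
abbrev ofCont (p : ℝ≥0∞) [Fact (1 ≤ p)] : C(AddCircle (1 : ℝ), ℂ) →L[ℂ] LpT p :=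
  ContinuousMap.toLp p μT ℂ

/-- The analytic trigonometric polynomial `A(z)`. -/
def analyticTrig : ℂ[X] →ₐ[ℂ] C(AddCircle (1 : ℝ), ℂ) := aeval (fourier 1)

/-- The antianalytic trigonometric polynomial `z⁻¹ B(z⁻¹)`. -/
def coanalyticTrig : ℂ[X] →ₗ[ℂ] C(AddCircle (1 : ℝ), ℂ) :=
  LinearMap.mulLeft ℂ (fourier (-1)) ∘ₗ (aeval (fourier (-1))).toLinearMap

theorem analyticTrig_apply (A : ℂ[X]) (t : AddCircle (1 : ℝ)) :
    analyticTrig A t = A.eval (bdry t) := by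
  rw [analyticTrig, aeval_continuousMap_apply, fourier_one_eq_bdry]

theorem fourier_neg_one_eq (t : AddCircle (1 : ℝ)) : fourier (-1) t = conj (bdry t) := by
  rw [fourier_neg, fourier_one_eq_bdry]

theorem coanalyticTrig_apply (B : ℂ[X]) (t : AddCircle (1 : ℝ)) :
    coanalyticTrig B t = conj (bdry t) * B.eval (conj (bdry t)) := by
  rw [coanalyticTrig, LinearMap.comp_apply, LinearMap.mulLeft_apply, ContinuousMap.mul_apply,
    AlgHom.toLinearMap_apply, aeval_continuousMap_apply, fourier_neg_one_eq]

theorem fourierCoeff_ofCont (p : ℝ≥0∞) [Fact (1 ≤ p)] (φ : C(AddCircle (1 : ℝ), ℂ)) (n : ℤ) :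
    fourierCoeff (ofCont p φ) n = fourierCoeff φ n :=
  congrFun (fourierCoeff_congr_ae (ContinuousMap.coeFn_toLp μT φ)) n

theorem fourierCoeff_analyticTrig (A : ℂ[X]) (n : ℤ) :
    fourierCoeff (analyticTrig A) n = if 0 ≤ n then A.coeff n.toNat else 0 := by
  rw [← fourierCoeff_eval]
  congr 1
  ext t
  exact analyticTrig_apply A t

theorem ofCont_analyticTrig_mem (p : ℝ≥0∞) [Fact (1 ≤ p)] (A : ℂ[X]) :
    ofCont p (analyticTrig A) ∈ Hp p := fun n hn => by
  rw [fourierCoeff_ofCont, fourierCoeff_analyticTrig, if_neg (by omega)]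

theorem coanalyticTrig_monomial (i : ℕ) (a : ℂ) :
    coanalyticTrig (monomial i a) = a • fourier (-(i + 1 : ℤ)) := by
  ext t
  rw [coanalyticTrig_apply, eval_monomial, ContinuousMap.smul_apply, smul_eq_mul, fourier_neg,
    fourier_add, fourier_one_eq_bdry, map_mul]
  simp [bdry, AddCircle.toCircle_nsmul]
  ring

theorem ofCont_coanalyticTrig_mem (p : ℝ≥0∞) [Fact (1 ≤ p)] (B : ℂ[X]) :
    ofCont p (coanalyticTrig B) ∈ Kp p := by
  induction B using Polynomial.induction_on' with
  | add B B' hB hB' =>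
    rw [map_add, map_add]
    exact (Kp p).add_mem hB hB'
  | monomial i a =>
    rw [coanalyticTrig_monomial, map_smul]
    refine (Kp p).smul_mem a fun n hn => ?_
    rw [fourierCoeff_ofCont, fourierCoeff_fourier, Pi.single_eq_of_ne (by omega)]

theorem exists_of_mem_span_fourier {τ : C(AddCircle (1 : ℝ), ℂ)}
    (hτ : τ ∈ Submodule.span ℂ (Set.range (fourier (T := 1)))) :
    ∃ A B : ℂ[X], τ = analyticTrig A + coanalyticTrig B := by
  have h : Submodule.span ℂ (Set.range (fourier (T := 1))) ≤
      LinearMap.range (analyticTrig.toLinearMap.coprod coanalyticTrig) := by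
    rw [Submodule.span_le]
    rintro _ ⟨n, rfl⟩
    obtain ⟨k, rfl⟩ | ⟨k, rfl⟩ : (∃ k : ℕ, n = k) ∨ ∃ k : ℕ, n = -(k + 1 : ℤ) := by
      rcases lt_or_ge n 0 with h | h
      · exact Or.inr ⟨(-n - 1).toNat, by omega⟩
      · exact Or.inl ⟨n.toNat, by omega⟩
    · refine ⟨(X ^ k, 0), ?_⟩
      ext t
      simp [analyticTrig_apply, bdry, AddCircle.toCircle_nsmul]
    · refine ⟨(0, monomial k 1), ?_⟩
      simp [coanalyticTrig_monomial]
  obtain ⟨⟨A, B⟩, hAB⟩ := h hτ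
  exact ⟨A, B, by simpa using hAB.symm⟩

theorem norm_ofCont {p : ℝ≥0∞} [Fact (1 ≤ p)] (hp : p ≠ ∞) (φ : C(AddCircle (1 : ℝ), ℂ)) :
    ‖ofCont p φ‖ = (∫ t, ‖φ t‖ ^ p.toReal ∂μT) ^ p.toReal⁻¹ := by
  have hp0 : p ≠ 0 := (zero_lt_one.trans_le (Fact.out : 1 ≤ p)).ne'
  rw [Lp.norm_def, eLpNorm_congr_ae (ContinuousMap.coeFn_toLp μT φ),
    MemLp.eLpNorm_eq_integral_rpow_norm hp0 hp (memLp_continuous φ.continuous),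
    ENNReal.toReal_ofReal]
  exact Real.rpow_nonneg (integral_nonneg fun t => Real.rpow_nonneg (norm_nonneg _) _) _

theorem norm_ofCont_mono {p : ℝ≥0∞} [Fact (1 ≤ p)] {φ ψ : C(AddCircle (1 : ℝ), ℂ)}
    (h : ∀ t, ‖φ t‖ ≤ ‖ψ t‖) : ‖ofCont p φ‖ ≤ ‖ofCont p ψ‖ := by
  refine Lp.norm_le_norm_of_ae_le ?_
  filter_upwards [ContinuousMap.coeFn_toLp (p := p) (𝕜 := ℂ) μT φ,
    ContinuousMap.coeFn_toLp (p := p) (𝕜 := ℂ) μT ψ] with t h1 h2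
  rw [h1, h2]
  exact h t

theorem norm_ofCont_le {p : ℝ≥0∞} [Fact (1 ≤ p)] {φ : C(AddCircle (1 : ℝ), ℂ)} {C : ℝ}
    (hC : 0 ≤ C) (h : ∀ t, ‖φ t‖ ≤ C) : ‖ofCont p φ‖ ≤ C := by
  have := Lp.norm_le_of_ae_bound (f := ofCont p φ) hC (by
    filter_upwards [ContinuousMap.coeFn_toLp (p := p) (𝕜 := ℂ) μT φ] with t h1
    rw [h1]
    exact h t)
  simpa [measureUnivNNReal] using this

/-- Gives access to the mean value property of holomorphic functions. -/
theorem integral_comp_bdry (F : ℂ → ℂ) :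
    ∫ t, F (bdry t) ∂μT = Real.circleAverage F 0 1 := by
  have h := fourierCoeff_eq_intervalIntegral (T := 1) (fun t => F (bdry t)) 0 0
  have h1 : fourierCoeff (fun t : AddCircle (1 : ℝ) => F (bdry t)) 0 = ∫ t, F (bdry t) ∂μT := by
    simp [fourierCoeff]
  rw [← h1, h, Real.circleAverage]
  have h2 := intervalIntegral.integral_comp_mul_left (a := 0) (b := 1)
    (fun θ => F (circleMap 0 1 θ)) (c := 2 * Real.pi) (by positivity)
  rw [mul_zero, mul_one] at h2
  rw [← h2, zero_add, div_one, one_smul]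
  refine intervalIntegral.integral_congr fun x _ => ?_
  have h3 : bdry (x : AddCircle (1 : ℝ)) = circleMap 0 1 (2 * Real.pi * x) := by
    rw [← fourier_one_eq_bdry, fourier_coe_apply, circleMap]
    push_cast
    simp
    ring_nf
  simp [h3]

/-! ### The theorem of M. Riesz for exponents at most two. -/

/-- Calderón's pointwise inequality behind the theorem of M. Riesz. -/
theorem exists_norm_rpow_le {p : ℝ} (hp : 1 < p) (hp2 : p ≤ 2) : ∃ A B : ℝ, 0 ≤ A ∧ 0 ≤ B ∧
    ∀ w : ℂ, 0 < w.re → ‖w‖ ^ p ≤ A * w.re ^ p - B * (w ^ (p : ℂ)).re := by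
  have hpi := Real.pi_pos
  -- The midpoint of `π/(2p)` and `π/2`: thus `cos θ > 0` while `cos (pθ) < 0`.
  set θ : ℝ := (Real.pi / 2 + Real.pi / (2 * p)) / 2 with hθ
  have hlt : Real.pi / (2 * p) < Real.pi / 2 := by
    apply div_lt_div_of_pos_left hpi <;> linarith
  have hpos : 0 < Real.pi / (2 * p) := by positivity
  have hθ2 : θ < Real.pi / 2 := by rw [hθ]; linarith
  have hθ0 : 0 < θ := by rw [hθ]; linarith
  have hpθ : Real.pi / 2 < p * θ := by
    have : p * (Real.pi / (2 * p)) = Real.pi / 2 := by field_simp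
    rw [← this]
    exact mul_lt_mul_of_pos_left (by rw [hθ]; linarith) (by linarith)
  have hpθ' : p * θ ≤ Real.pi := by nlinarith
  have hc : 0 < -Real.cos (p * θ) :=
    neg_pos.2 (Real.cos_neg_of_pi_div_two_lt_of_lt hpθ (by linarith))
  have hcθ : 0 < Real.cos θ := Real.cos_pos_of_mem_Ioo ⟨by linarith, hθ2⟩
  set c := -Real.cos (p * θ) with hcdef
  have hd : 0 < Real.cos θ ^ p := Real.rpow_pos_of_pos hcθ p
  -- For `|arg w| ≥ θ` the factor `1/c` makes the subtracted term at most `-‖w‖ ^ p`; for `|arg w| ≤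
  -- θ` the first constant outweighs that term. Here `p ≤ 2` keeps `p |arg w|` in `[0, π]`, where
  -- the cosine decreases.
  refine ⟨(1 + 1 / c) / Real.cos θ ^ p, 1 / c, by positivity, by positivity, fun w hw => ?_⟩
  have hw0 : w ≠ 0 := by
    rintro rfl
    simp at hw
  have hn : 0 < ‖w‖ := norm_pos_iff.2 hw0
  have harg : |w.arg| < Real.pi / 2 := Complex.abs_arg_lt_pi_div_two_iff.2 (Or.inl hw)
  have hre : w.re = ‖w‖ * Real.cos |w.arg| := by
    rw [Real.cos_abs, Complex.norm_mul_cos_arg]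
  have hre2 : (w ^ (p : ℂ)).re = ‖w‖ ^ p * Real.cos (p * |w.arg|) := by
    rw [Complex.cpow_ofReal_re, ← Real.cos_abs (w.arg * p), abs_mul, abs_of_pos (by linarith : 0 < p),
      mul_comm p]
  generalize hφ : |w.arg| = φ at *
  have hφ0 : 0 ≤ φ := hφ ▸ abs_nonneg _
  have hcφ : 0 < Real.cos φ := Real.cos_pos_of_mem_Ioo ⟨by linarith, harg⟩
  have key : 1 ≤ (1 + 1 / c) / Real.cos θ ^ p * Real.cos φ ^ p - 1 / c * Real.cos (p * φ) := by
    rcases le_total φ θ with h | h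
    · have h1 : Real.cos θ ≤ Real.cos φ := Real.cos_le_cos_of_nonneg_of_le_pi hφ0 (by linarith) h
      have h2 : Real.cos θ ^ p ≤ Real.cos φ ^ p := Real.rpow_le_rpow hcθ.le h1 (by linarith)
      have h3 : 1 + 1 / c ≤ (1 + 1 / c) / Real.cos θ ^ p * Real.cos φ ^ p := by
        rw [div_mul_eq_mul_div, le_div_iff₀ hd]
        exact mul_le_mul_of_nonneg_left h2 (by positivity)
      have h4 : 1 / c * Real.cos (p * φ) ≤ 1 / c :=
        mul_le_of_le_one_right (by positivity) (Real.cos_le_one _)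
      linarith
    · have h1 : Real.cos (p * φ) ≤ Real.cos (p * θ) := by
        refine Real.cos_le_cos_of_nonneg_of_le_pi (by positivity) ?_
          (mul_le_mul_of_nonneg_left h (by linarith))
        nlinarith
      have h2 : 1 / c * Real.cos (p * φ) ≤ -1 := by
        rw [div_mul_eq_mul_div, div_le_iff₀ hc]
        linarith
      have h3 : 0 ≤ (1 + 1 / c) / Real.cos θ ^ p * Real.cos φ ^ p := by positivity
      linarith
  rw [hre, hre2, Real.mul_rpow hn.le hcφ.le]
  have := mul_le_mul_of_nonneg_left key (Real.rpow_nonneg hn.le p)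
  linarith

theorem exists_bdry_eq {z : ℂ} (hz : ‖z‖ = 1) : ∃ t, bdry t = z := by
  obtain ⟨t, ht⟩ := (AddCircle.homeomorphCircle (T := 1) one_ne_zero).surjective
    (⟨z, mem_sphere_zero_iff_norm.2 hz⟩ : Circle)
  refine ⟨t, ?_⟩
  rw [AddCircle.homeomorphCircle_apply] at ht
  rw [bdry, ht]

/-- A polynomial with positive real part on the circle has positive real part in the disc. -/
theorem eval_re_pos {G : ℂ[X]} (hG : ∀ t, 0 < (G.eval (bdry t)).re) {z : ℂ} (hz : ‖z‖ ≤ 1) :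
    0 < (G.eval z).re := by
  obtain ⟨t₀, -, ht₀⟩ := isCompact_univ.exists_isMinOn (Set.univ_nonempty)
    (Complex.continuous_re.comp (continuous_eval_bdry G)).continuousOn
  set m := (G.eval (bdry t₀)).re
  -- The maximum principle is applied to `exp (-G)`, of modulus `exp (-Re G)`.
  have hd : Differentiable ℂ fun z => Complex.exp (-G.eval z) := by
    fun_prop
  have h := Complex.norm_le_of_forall_mem_frontier_norm_le (U := Metric.ball (0 : ℂ) 1)
    (f := fun z => Complex.exp (-G.eval z)) (C := Real.exp (-m)) Metric.isBounded_ball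
    hd.diffContOnCl (fun w hw => by
      rw [frontier_ball _ one_ne_zero, mem_sphere_zero_iff_norm] at hw
      obtain ⟨t, rfl⟩ := exists_bdry_eq hw
      rw [Complex.norm_exp, Complex.neg_re, Real.exp_le_exp, neg_le_neg_iff]
      exact ht₀ (Set.mem_univ t)) (z := z) (by
      rw [closure_ball _ one_ne_zero]
      simpa using hz)
  rw [Complex.norm_exp, Complex.neg_re, Real.exp_le_exp, neg_le_neg_iff] at h
  exact (hG t₀).trans_le h

/-- The continuous function `Re φ`. -/
def reCont (φ : C(AddCircle (1 : ℝ), ℂ)) : C(AddCircle (1 : ℝ), ℂ) :=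
  ⟨fun t => ((φ t).re : ℂ), by fun_prop⟩

theorem reCont_apply (φ : C(AddCircle (1 : ℝ), ℂ)) (t : AddCircle (1 : ℝ)) :
    reCont φ t = ((φ t).re : ℂ) := rfl

/-- Calderón's inequality is integrated over the circle. By the mean value property `G ^ p` has mean
`G(0) ^ p`, which is nonnegative because `G(0)` is real and positive, so the subtracted term can be
dropped. -/
theorem exists_norm_le_of_re_pos {p : ℝ≥0∞} [Fact (1 ≤ p)] (hp : 1 < p) (hp2 : p ≤ 2) :
    ∃ C : ℝ, 0 ≤ C ∧ ∀ G : ℂ[X], (∀ t, 0 < (G.eval (bdry t)).re) → (G.eval 0).im = 0 →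
      ‖ofCont p (analyticTrig G)‖ ≤ C * ‖ofCont p (reCont (analyticTrig G))‖ := by
  have hpt : p ≠ ∞ := ne_top_of_le_ne_top (by simp) hp2
  set r := p.toReal with hr
  have hr1 : 1 < r := by
    rw [hr, ← ENNReal.toReal_one]
    exact (ENNReal.toReal_lt_toReal (by simp) hpt).2 hp
  have hr2 : r ≤ 2 := by
    rw [hr, show (2 : ℝ) = (2 : ℝ≥0∞).toReal by simp]
    exact ENNReal.toReal_mono (by simp) hp2
  obtain ⟨A, B, hA, hB, hAB⟩ := exists_norm_rpow_le hr1 hr2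
  refine ⟨A ^ r⁻¹, Real.rpow_nonneg hA _, fun G hG hG0 => ?_⟩
  have hcont : Continuous fun t => G.eval (bdry t) := continuous_eval_bdry G
  have hI : ∀ {u : AddCircle (1 : ℝ) → ℝ}, Continuous u → Integrable u μT := fun hu =>
    hu.integrable_of_hasCompactSupport (HasCompactSupport.of_compactSpace _)
  have hc1 : Continuous fun t => ‖G.eval (bdry t)‖ ^ r :=
    hcont.norm.rpow_const fun t => Or.inr (by linarith)
  have hc2 : Continuous fun t => (G.eval (bdry t)).re ^ r :=
    (Complex.continuous_re.comp hcont).rpow_const fun t => Or.inr (by linarith)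
  have hc3 : Continuous fun t => G.eval (bdry t) ^ (r : ℂ) :=
    hcont.cpow continuous_const fun t => Or.inl (hG t)
  have hmean : ∫ t, G.eval (bdry t) ^ (r : ℂ) ∂μT = G.eval 0 ^ (r : ℂ) := by
    rw [integral_comp_bdry fun z => G.eval z ^ (r : ℂ)]
    refine DiffContOnCl.circleAverage (DifferentiableOn.diffContOnCl fun z hz => ?_)
    rw [abs_one, closure_ball _ one_ne_zero, mem_closedBall_zero_iff] at hz
    exact (G.differentiable z).differentiableWithinAt.cpow (differentiableWithinAt_const _)
      (Or.inl (eval_re_pos hG hz))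
  have h0 : G.eval 0 = (((G.eval 0).re : ℝ) : ℂ) := Complex.ext rfl (by simpa using hG0)
  have hpos := eval_re_pos hG (z := 0) (by simp)
  have hmre : 0 ≤ ∫ t, (G.eval (bdry t) ^ (r : ℂ)).re ∂μT := by
    have hci : Integrable (fun t => G.eval (bdry t) ^ (r : ℂ)) μT :=
      (memLp_continuous (p := 1) hc3).integrable le_rfl
    have h1 := integral_re hci
    change ∫ t, (G.eval (bdry t) ^ (r : ℂ)).re ∂μT = (∫ t, G.eval (bdry t) ^ (r : ℂ) ∂μT).re at h1
    rw [h1, hmean, h0, ← Complex.ofReal_cpow hpos.le, Complex.ofReal_re]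
    exact Real.rpow_nonneg hpos.le _
  have hint : ∫ t, ‖G.eval (bdry t)‖ ^ r ∂μT ≤ A * ∫ t, (G.eval (bdry t)).re ^ r ∂μT := by
    have h1 := integral_mono (hI hc1) (((hI hc2).const_mul A).sub
      ((hI (Complex.continuous_re.comp hc3)).const_mul B)) fun t => hAB _ (hG t)
    have h2 := integral_sub ((hI hc2).const_mul A)
      ((hI (Complex.continuous_re.comp hc3)).const_mul B)
    rw [integral_const_mul, integral_const_mul] at h2
    refine h1.trans (h2.le.trans ?_)
    have : 0 ≤ B * ∫ t, (G.eval (bdry t) ^ (r : ℂ)).re ∂μT := mul_nonneg hB hmre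
    simp only [Function.comp_apply]
    linarith
  rw [norm_ofCont hpt, norm_ofCont hpt, ← Real.mul_rpow hA
    (integral_nonneg fun t => Real.rpow_nonneg (norm_nonneg _) _)]
  refine Real.rpow_le_rpow (integral_nonneg fun t => Real.rpow_nonneg (norm_nonneg _) _) ?_
    (by positivity)
  simp only [analyticTrig_apply, reCont_apply, Complex.norm_real, Real.norm_eq_abs]
  refine hint.trans_eq ?_
  congr 2
  ext t
  rw [abs_of_pos (hG t)]

theorem conj_eval (B : ℂ[X]) (z : ℂ) :
    conj (B.eval z) = (B.map (starRingEnd ℂ)).eval (conj z) := by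
  rw [eval_map, eval₂_at_apply]

/-- Every real continuous function is a uniform limit of real parts of polynomials. -/
theorem exists_re_approx {u : AddCircle (1 : ℝ) → ℝ} (hu : Continuous u) {ε : ℝ} (hε : 0 < ε) :
    ∃ H : ℂ[X], (H.eval 0).im = 0 ∧ ∀ t, |(H.eval (bdry t)).re - u t| < ε := by
  let ψ : C(AddCircle (1 : ℝ), ℂ) := ⟨fun t => (u t : ℂ), by fun_prop⟩
  have hψ : ψ ∈ (Submodule.span ℂ (Set.range (fourier (T := 1)))).topologicalClosure := by
    rw [span_fourier_closure_eq_top]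
    trivial
  obtain ⟨τ, hτ, hd⟩ := Metric.mem_closure_iff.1 hψ ε hε
  obtain ⟨A, B, rfl⟩ := exists_of_mem_span_fourier hτ
  -- Conjugating the antianalytic part makes it analytic without changing its real part; subtracting
  -- the imaginary constant below normalizes the value at `0`.
  let H : ℂ[X] := A + X * B.map (starRingEnd ℂ)
  refine ⟨H - C (Complex.I * (H.eval 0).im), by simp, fun t => ?_⟩
  have h1 := (ContinuousMap.dist_apply_le_dist (f := ψ)
    (g := analyticTrig A + coanalyticTrig B) t).trans_lt hd
  rw [dist_comm, dist_eq_norm] at h1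
  refine lt_of_eq_of_lt ?_ ((Complex.abs_re_le_norm _).trans_lt h1)
  congr 1
  have h2 : (conj (bdry t) * B.eval (conj (bdry t))).re =
      (bdry t * (B.map (starRingEnd ℂ)).eval (bdry t)).re := by
    rw [← Complex.conj_re, map_mul, conj_eval, Complex.conj_conj]
  rw [ContinuousMap.add_apply, analyticTrig_apply, coanalyticTrig_apply, Complex.sub_re,
    Complex.add_re, h2]
  simp [H, ψ]

/-- The positivity assumption is removed by writing `G = H - (H - G)`, with `Re H` within `ε` of
`max (Re G) 0 + 2ε`. Both terms have positive real part, bounded by `|Re G| + 3ε`; then `ε → 0`. -/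
theorem exists_norm_le_re {p : ℝ≥0∞} [Fact (1 ≤ p)] (hp : 1 < p) (hp2 : p ≤ 2) :
    ∃ C : ℝ, 0 ≤ C ∧ ∀ G : ℂ[X], (G.eval 0).im = 0 →
      ‖ofCont p (analyticTrig G)‖ ≤ C * ‖ofCont p (reCont (analyticTrig G))‖ := by
  obtain ⟨C, hC, h⟩ := exists_norm_le_of_re_pos hp hp2
  refine ⟨2 * C, by positivity, fun G hG => ?_⟩
  set N := ‖ofCont p (reCont (analyticTrig G))‖ with hN
  have hε : ∀ ε > 0, ‖ofCont p (analyticTrig G)‖ ≤ 2 * C * N + 6 * C * ε := by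
    intro ε hε
    have hu : Continuous fun t => (G.eval (bdry t)).re :=
      Complex.continuous_re.comp (continuous_eval_bdry G)
    obtain ⟨H, hH0, hH⟩ := exists_re_approx
      (u := fun t => max (G.eval (bdry t)).re 0 + 2 * ε) (by fun_prop) hε
    have hb : ∀ Q : ℂ[X], (∀ t, |(Q.eval (bdry t)).re| ≤ |(G.eval (bdry t)).re| + 3 * ε) →
        ‖ofCont p (reCont (analyticTrig Q))‖ ≤ N + 3 * ε := by
      intro Q hQ
      let ψ : C(AddCircle (1 : ℝ), ℂ) := ⟨fun t => ((|(G.eval (bdry t)).re| : ℝ) : ℂ), by fun_prop⟩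
      let κ : C(AddCircle (1 : ℝ), ℂ) := ⟨fun _ => ((3 * ε : ℝ) : ℂ), continuous_const⟩
      have h1 : ‖ofCont p (reCont (analyticTrig Q))‖ ≤ ‖ofCont p (ψ + κ)‖ :=
        norm_ofCont_mono fun t => by
          have hs : (ψ + κ) t = ((|(G.eval (bdry t)).re| + 3 * ε : ℝ) : ℂ) := by
            simp [ψ, κ]
          rw [hs, reCont_apply, analyticTrig_apply, Complex.norm_real, Complex.norm_real,
            Real.norm_eq_abs, Real.norm_eq_abs, abs_of_nonneg (a := _ + _) (by positivity)]
          exact hQ t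
      have h2 : ‖ofCont p ψ‖ ≤ N := norm_ofCont_mono fun t => by
        simp [ψ, reCont_apply, analyticTrig_apply]
      have h3 : ‖ofCont p κ‖ ≤ 3 * ε := norm_ofCont_le (by positivity) fun t => by
        rw [show κ t = ((3 * ε : ℝ) : ℂ) from rfl, Complex.norm_real, Real.norm_eq_abs,
          abs_of_pos (by positivity)]
      rw [map_add] at h1
      exact h1.trans ((norm_add_le _ _).trans (add_le_add h2 h3))
    have hH' : ∀ t, 0 < (H.eval (bdry t)).re ∧
        |(H.eval (bdry t)).re| ≤ |(G.eval (bdry t)).re| + 3 * ε ∧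
        0 < ((H - G).eval (bdry t)).re ∧
        |((H - G).eval (bdry t)).re| ≤ |(G.eval (bdry t)).re| + 3 * ε := by
      intro t
      have h1 := abs_lt.1 (hH t)
      rw [eval_sub, Complex.sub_re]
      generalize (H.eval (bdry t)).re = a at *
      generalize (G.eval (bdry t)).re = b at *
      rcases le_total b 0 with hb | hb
      · rw [max_eq_right hb] at h1
        rw [abs_of_nonpos hb, abs_le, abs_le]
        refine ⟨?_, ⟨?_, ?_⟩, ?_, ?_, ?_⟩ <;> linarith
      · rw [max_eq_left hb] at h1
        rw [abs_of_nonneg hb, abs_le, abs_le]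
        refine ⟨?_, ⟨?_, ?_⟩, ?_, ?_, ?_⟩ <;> linarith
    have h1 := h H (fun t => (hH' t).1) hH0
    have h2 := h (H - G) (fun t => (hH' t).2.2.1) (by rw [eval_sub, Complex.sub_im, hH0, hG, sub_zero])
    have h3 := mul_le_mul_of_nonneg_left (hb H fun t => (hH' t).2.1) hC
    have h4 := mul_le_mul_of_nonneg_left (hb (H - G) fun t => (hH' t).2.2.2) hC
    have h5 : ofCont p (analyticTrig G) =
        ofCont p (analyticTrig H) - ofCont p (analyticTrig (H - G)) := by
      rw [map_sub, map_sub, sub_sub_cancel]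
    rw [h5]
    refine (norm_sub_le _ _).trans ?_
    linarith
  refine le_of_forall_pos_le_add fun δ hδ => ?_
  have hCp : 0 < 6 * C + 1 := by linarith
  refine (hε (δ / (6 * C + 1)) (by positivity)).trans ?_
  have : 6 * C * (δ / (6 * C + 1)) ≤ δ := by
    rw [mul_div_assoc', div_le_iff₀ hCp]
    nlinarith
  linarith

/-- Boundedness in `L^p` of the Riesz projection on trigonometric polynomials. -/
def RieszBound (p : ℝ≥0∞) [Fact (1 ≤ p)] : Prop :=
  ∃ C : ℝ, 0 ≤ C ∧ ∀ A B : ℂ[X],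
    ‖ofCont p (analyticTrig A)‖ ≤ C * ‖ofCont p (analyticTrig A + coanalyticTrig B)‖

theorem rieszBound_of_le_two {p : ℝ≥0∞} [Fact (1 ≤ p)] (hp : 1 < p) (hp2 : p ≤ 2) :
    RieszBound p := by
  obtain ⟨K, hK, h⟩ := exists_norm_le_re hp hp2
  refine ⟨2 * K + 1, by positivity, fun A B => ?_⟩
  set f := analyticTrig A + coanalyticTrig B with hf
  set N := ‖ofCont p f‖ with hN
  set D := B.map (starRingEnd ℂ) with hD
  have hft : ∀ t, f t = A.eval (bdry t) + conj (bdry t) * B.eval (conj (bdry t)) := fun t => by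
    rw [hf, ContinuousMap.add_apply, analyticTrig_apply, coanalyticTrig_apply]
  have hDt : ∀ t, bdry t * D.eval (bdry t) = conj (conj (bdry t) * B.eval (conj (bdry t))) :=
    fun t => by rw [map_mul, conj_eval, Complex.conj_conj]
  -- On the circle `Re G₁ = Re f` and `Re G₂ = Im f`, both `Gᵢ(0)` are real, and `2A = G₁ + i G₂ +
  -- A(0)`, where `A(0)` is the zeroth Fourier coefficient of `f`.
  let G₁ : ℂ[X] := A + X * D - C (Complex.I * ((A.eval 0).im : ℂ))
  let G₂ : ℂ[X] := C Complex.I * (X * D - A) + C (Complex.I * ((A.eval 0).re : ℂ))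
  have h₁ := h G₁ (by simp [G₁])
  have h₂ := h G₂ (by simp [G₂])
  have hr₁ : ‖ofCont p (reCont (analyticTrig G₁))‖ ≤ N := norm_ofCont_mono fun t => by
    have : (G₁.eval (bdry t)).re = (f t).re := by
      simp only [G₁, eval_sub, eval_add, eval_mul, eval_X, eval_C, hDt, hft]
      simp
    rw [reCont_apply, analyticTrig_apply, this, Complex.norm_real]
    exact Complex.abs_re_le_norm _
  have hr₂ : ‖ofCont p (reCont (analyticTrig G₂))‖ ≤ N := norm_ofCont_mono fun t => by
    have : (G₂.eval (bdry t)).re = (f t).im := by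
      simp only [G₂, eval_sub, eval_add, eval_mul, eval_X, eval_C, hDt, hft]
      simp
      ring
    rw [reCont_apply, analyticTrig_apply, this, Complex.norm_real]
    exact Complex.abs_im_le_norm _
  have h0 : ‖A.eval 0‖ ≤ N := by
    have h1 : fourierCoeff (ofCont p f) 0 = A.eval 0 := by
      rw [hf, map_add, fourierCoeff_add', ofCont_coanalyticTrig_mem p B 0 le_rfl,
        fourierCoeff_ofCont, fourierCoeff_analyticTrig]
      simp [coeff_zero_eq_eval_zero]
    rw [← h1]
    exact norm_fourierCoeff_le _ _
  have hc : ‖ofCont p (analyticTrig (C (A.eval 0)))‖ ≤ N :=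
    (norm_ofCont_le (norm_nonneg (A.eval 0)) fun t => by
      rw [analyticTrig_apply, eval_C]).trans h0
  have hA : (2 : ℂ) • A = G₁ + Complex.I • G₂ + C (A.eval 0) := by
    have hI : (C Complex.I : ℂ[X]) * C Complex.I = -1 := by
      rw [← C_mul, Complex.I_mul_I, C_neg, C_1]
    have h0 : (C (A.eval 0) : ℂ[X]) =
        C ((A.eval 0).re : ℂ) + C ((A.eval 0).im : ℂ) * C Complex.I := by
      rw [← C_mul, ← C_add, Complex.re_add_im]
    simp only [G₁, G₂, smul_eq_C_mul, C_mul, h0, show (C (2 : ℂ) : ℂ[X]) = 2 from rfl]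
    linear_combination (-(X * D) + A - C ((A.eval 0).re : ℂ)) * hI
  have h2 : (2 : ℂ) • ofCont p (analyticTrig A) = ofCont p (analyticTrig G₁) +
      Complex.I • ofCont p (analyticTrig G₂) + ofCont p (analyticTrig (C (A.eval 0))) := by
    rw [← map_smul, ← map_smul, hA]
    simp only [map_add, map_smul]
  have h3 : 2 * ‖ofCont p (analyticTrig A)‖ ≤ K * N + K * N + N := by
    have h4 : ‖(2 : ℂ) • ofCont p (analyticTrig A)‖ = 2 * ‖ofCont p (analyticTrig A)‖ := by
      rw [norm_smul]
      simp
    rw [← h4, h2]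
    refine (norm_add₃_le).trans ?_
    rw [norm_smul, Complex.norm_I, one_mul]
    exact add_le_add_three (h₁.trans (mul_le_mul_of_nonneg_left hr₁ hK))
      (h₂.trans (mul_le_mul_of_nonneg_left hr₂ hK)) hc
  have hN0 : 0 ≤ N := norm_nonneg _
  nlinarith [mul_nonneg hK hN0]

/-! ### Doubling the exponent. -/

theorem norm_ofCont_sq {p q : ℝ≥0∞} [Fact (1 ≤ p)] [Fact (1 ≤ q)] (hp : p ≠ ∞) (hq : q = 2 * p)
    (φ : C(AddCircle (1 : ℝ), ℂ)) : ‖ofCont p (φ ^ 2)‖ = ‖ofCont q φ‖ ^ 2 := by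
  have hqt : q ≠ ∞ := hq ▸ ENNReal.mul_ne_top (by simp) hp
  have hqr : q.toReal = 2 * p.toReal := by rw [hq, ENNReal.toReal_mul]; simp
  have hp0 : p.toReal ≠ 0 := ENNReal.toReal_ne_zero.2
    ⟨(zero_lt_one.trans_le (Fact.out : 1 ≤ p)).ne', hp⟩
  rw [norm_ofCont hp, norm_ofCont hqt, ← Real.rpow_natCast, ← Real.rpow_mul
    (integral_nonneg fun t => Real.rpow_nonneg (norm_nonneg _) _), hqr]
  congr 1
  · congr 1
    ext t
    rw [ContinuousMap.pow_apply, norm_pow, ← Real.rpow_natCast, ← Real.rpow_mul (norm_nonneg _)]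
    simp
  · field_simp
    simp

theorem norm_ofCont_mul_le {p q : ℝ≥0∞} [Fact (1 ≤ p)] [Fact (1 ≤ q)] (hp : p ≠ ∞)
    (hq : q = 2 * p) (φ ψ : C(AddCircle (1 : ℝ), ℂ)) :
    ‖ofCont p (φ * ψ)‖ ≤ ‖ofCont q φ‖ * ‖ofCont q ψ‖ := by
  have hqt : q ≠ ∞ := hq ▸ ENNReal.mul_ne_top (by simp) hp
  have hqr : q.toReal = 2 * p.toReal := by rw [hq, ENNReal.toReal_mul]; simp
  have hp0 : p.toReal ≠ 0 := ENNReal.toReal_ne_zero.2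
    ⟨(zero_lt_one.trans_le (Fact.out : 1 ≤ p)).ne', hp⟩
  have hpos : ∀ (χ : C(AddCircle (1 : ℝ), ℂ)) (s : ℝ), 0 ≤ ∫ t, ‖χ t‖ ^ s ∂μT := fun χ s =>
    integral_nonneg fun t => Real.rpow_nonneg (norm_nonneg _) _
  have hL : ∀ χ : C(AddCircle (1 : ℝ), ℂ),
      MemLp (fun t => ‖χ t‖ ^ p.toReal) (ENNReal.ofReal 2) μT := fun χ => by
    have hc : Continuous fun t => ‖χ t‖ ^ p.toReal :=
      χ.continuous.norm.rpow_const fun t => Or.inr ENNReal.toReal_nonneg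
    obtain ⟨C, hC⟩ := isCompact_univ.exists_bound_of_continuousOn hc.continuousOn
    exact MemLp.of_bound hc.aestronglyMeasurable C (Eventually.of_forall fun t => hC t trivial)
  have h := integral_mul_le_Lp_mul_Lq_of_nonneg Real.HolderConjugate.two_two
    (Eventually.of_forall fun t => Real.rpow_nonneg (norm_nonneg (φ t)) p.toReal)
    (Eventually.of_forall fun t => Real.rpow_nonneg (norm_nonneg (ψ t)) p.toReal) (hL φ) (hL ψ)
  have hpw : ∀ χ : C(AddCircle (1 : ℝ), ℂ), ∀ t,
      (‖χ t‖ ^ p.toReal) ^ (2 : ℝ) = ‖χ t‖ ^ q.toReal := fun χ t => by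
    rw [← Real.rpow_mul (norm_nonneg _), hqr, mul_comm]
  have hex : 1 / (2 : ℝ) * p.toReal⁻¹ = q.toReal⁻¹ := by
    rw [hqr]
    field_simp
  simp only [hpw, ← Real.mul_rpow (norm_nonneg _) (norm_nonneg _), ← norm_mul] at h
  rw [norm_ofCont hp, norm_ofCont hqt, norm_ofCont hqt, ← hex, Real.rpow_mul (hpos φ _),
    Real.rpow_mul (hpos ψ _), ← Real.mul_rpow (Real.rpow_nonneg (hpos φ _) _)
      (Real.rpow_nonneg (hpos ψ _) _)]
  exact Real.rpow_le_rpow (hpos _ _) h (inv_nonneg.2 ENNReal.toReal_nonneg)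

/-- Cotlar's doubling argument. -/
theorem RieszBound.two_mul {p q : ℝ≥0∞} [Fact (1 ≤ p)] [Fact (1 ≤ q)] (hp : p ≠ ∞)
    (hq : q = 2 * p) (h : RieszBound p) : RieszBound q := by
  obtain ⟨K, hK, h⟩ := h
  refine ⟨3 * K + 1, by positivity, fun A B => ?_⟩
  -- With `b` the antianalytic part, this is the bound for `A² - b² = (A - b)(A + b)`, whose
  -- projection is `A²`; the factor `X` accounts for the second `z⁻¹` in `b²`.
  have h1 := h (A ^ 2) (-(X * B ^ 2))
  have h2 : analyticTrig (A ^ 2) + coanalyticTrig (-(X * B ^ 2)) =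
      (analyticTrig A - coanalyticTrig B) * (analyticTrig A + coanalyticTrig B) := by
    ext t
    simp only [ContinuousMap.add_apply, ContinuousMap.mul_apply, ContinuousMap.sub_apply,
      analyticTrig_apply, coanalyticTrig_apply, eval_neg, eval_mul, eval_pow, eval_X]
    ring
  rw [h2, map_pow, norm_ofCont_sq hp hq] at h1
  have h3 := norm_ofCont_mul_le hp hq (analyticTrig A - coanalyticTrig B)
    (analyticTrig A + coanalyticTrig B)
  set x := ‖ofCont q (analyticTrig A)‖ with hx
  set y := ‖ofCont q (analyticTrig A + coanalyticTrig B)‖ with hy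
  have h4 : ‖ofCont q (analyticTrig A - coanalyticTrig B)‖ ≤ 2 * x + y := by
    have h5 : analyticTrig A - coanalyticTrig B =
        (2 : ℂ) • analyticTrig A - (analyticTrig A + coanalyticTrig B) := by
      ext t
      simp only [ContinuousMap.add_apply, ContinuousMap.sub_apply, ContinuousMap.smul_apply,
        smul_eq_mul]
      ring
    rw [h5, map_sub, map_smul]
    refine (norm_sub_le _ _).trans ?_
    rw [norm_smul]
    simp [hx, hy]
  have hx0 : 0 ≤ x := norm_nonneg _
  have hy0 : 0 ≤ y := norm_nonneg _
  have h5 : x ^ 2 ≤ K * ((2 * x + y) * y) :=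
    h1.trans (mul_le_mul_of_nonneg_left (h3.trans (mul_le_mul_of_nonneg_right h4 hy0)) hK)
  -- If `x > (3K + 1)y`, then `y ≤ x` and `x² ≤ K(2x + y)y ≤ 3Kxy`, a contradiction.
  by_contra hcon
  push Not at hcon
  have hKy : 0 ≤ K * y := mul_nonneg hK hy0
  have hxy : y ≤ x := by nlinarith
  have hxp : 0 < x := by nlinarith
  nlinarith [mul_lt_mul_of_pos_left hcon hxp, mul_nonneg hKy (sub_nonneg.2 hxy),
    mul_nonneg hx0 hy0]

/-- The theorem of M. Riesz. -/
theorem rieszBound {p : ℝ≥0∞} [Fact (1 ≤ p)] (hp : 1 < p) (hp' : p ≠ ∞) : RieszBound p := by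
  have key : ∀ (n : ℕ) (p : ℝ≥0∞) [Fact (1 ≤ p)], 1 < p → p ≤ 2 ^ (n + 1) → RieszBound p := by
    intro n
    induction n with
    | zero => exact fun p _ hp h => rieszBound_of_le_two hp (by simpa using h)
    | succ n ih =>
      intro p _ hp h
      rcases le_or_gt p 2 with hp2 | hp2
      · exact rieszBound_of_le_two hp hp2
      have h2 : p = 2 * (p / 2) := (ENNReal.mul_div_cancel (by simp) (by simp)).symm
      have h1 : 1 < p / 2 := by
        rwa [ENNReal.lt_div_iff_mul_lt (by simp) (by simp), one_mul]
      have : Fact (1 ≤ p / 2) := ⟨h1.le⟩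
      have hle : p / 2 ≤ 2 ^ (n + 1) := ENNReal.div_le_of_le_mul (by rwa [pow_succ] at h)
      exact (ih (p / 2) h1 hle).two_mul (ne_top_of_le_ne_top (by simp) hle) h2
  obtain ⟨n, hn⟩ := exists_nat_gt p.toReal
  refine key n p hp ?_
  have h1 : p ≤ (n : ℝ≥0∞) := by
    rw [← ENNReal.ofReal_toReal hp', ← ENNReal.ofReal_natCast]
    exact ENNReal.ofReal_le_ofReal hn.le
  refine h1.trans ?_
  exact_mod_cast (Nat.lt_two_pow_self (n := n)).le.trans (Nat.pow_le_pow_right two_pos n.le_succ)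

/-! ### Existence of the Riesz projection and density of polynomials. -/

/-- The Riesz projection of an element of `L^p` exists and is a limit of polynomials. -/
theorem exists_rieszProj_tendsto {p : ℝ≥0∞} [Fact (1 ≤ p)] (hp : 1 < p) (hp' : p ≠ ∞)
    (f : LpT p) : ∃ (h : Hp p) (A : ℕ → ℂ[X]), IsRieszProj f h ∧
      Tendsto (fun n => ofCont p (analyticTrig (A n))) atTop (𝓝 (h : LpT p)) := by
  obtain ⟨K, hK, hb⟩ := rieszBound hp hp'
  have hf : f ∈ closure (Set.range fun x : ℂ[X] × ℂ[X] =>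
      ofCont p (analyticTrig x.1 + coanalyticTrig x.2)) := by
    have h1 : f ∈ (Submodule.span ℂ (Set.range (fourierLp (T := 1) p))).topologicalClosure := by
      rw [span_fourierLp_closure_eq_top hp']
      trivial
    refine closure_mono ?_ h1
    have h2 : Set.range (fourierLp (T := 1) p) = ofCont p '' Set.range (fourier (T := 1)) := by
      rw [← Set.range_comp]
      rfl
    intro g hg
    rw [h2, SetLike.mem_coe, ← ContinuousLinearMap.coe_coe, Submodule.span_image] at hg
    obtain ⟨τ, hτ, rfl⟩ := hg
    obtain ⟨A, B, rfl⟩ := exists_of_mem_span_fourier hτ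
    exact ⟨(A, B), rfl⟩
  obtain ⟨u, hu, hlim⟩ := mem_closure_iff_seq_limit.1 hf
  choose x hx using hu
  -- The Riesz bound, applied to differences, carries the Cauchy property over to analytic parts.
  have hcau : CauchySeq fun n => ofCont p (analyticTrig (x n).1) := by
    have hc := hlim.cauchySeq
    rw [Metric.cauchySeq_iff'] at hc ⊢
    intro ε hε
    obtain ⟨N, hN⟩ := hc (ε / (K + 1)) (by positivity)
    refine ⟨N, fun n hn => ?_⟩
    have h1 := hN n hn
    rw [lt_div_iff₀ (by positivity), dist_eq_norm, ← hx, ← hx, ← map_sub] at h1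
    have h2 := hb ((x n).1 - (x N).1) ((x n).2 - (x N).2)
    rw [map_sub analyticTrig, map_sub coanalyticTrig, ← add_sub_add_comm] at h2
    rw [dist_eq_norm, ← map_sub]
    refine h2.trans_lt (lt_of_le_of_lt ?_ h1)
    rw [mul_comm]
    exact mul_le_mul_of_nonneg_left (by linarith) (norm_nonneg _)
  obtain ⟨h, hh⟩ := cauchySeq_tendsto_of_complete hcau
  have hH : h ∈ Hp p := (isClosed_Hp p).mem_of_tendsto hh
    (Eventually.of_forall fun n => ofCont_analyticTrig_mem p _)
  refine ⟨⟨h, hH⟩, fun n => (x n).1, ?_, hh⟩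
  refine (isClosed_Kp p).mem_of_tendsto (hlim.sub hh) (Eventually.of_forall fun n => ?_)
  rw [← hx, ← map_sub, add_sub_cancel_left]
  exact ofCont_coanalyticTrig_mem p _

theorem exists_isRieszProj {p : ℝ≥0∞} [Fact (1 ≤ p)] (hp : 1 < p) (hp' : p ≠ ∞) (f : LpT p) :
    ∃ h : Hp p, IsRieszProj f h := by
  obtain ⟨h, -, hh, -⟩ := exists_rieszProj_tendsto hp hp' f
  exact ⟨h, hh⟩

/-- The polynomial `A` as an element of `H^p`. -/
def polyHp (p : ℝ≥0∞) [Fact (1 ≤ p)] (A : ℂ[X]) : Hp p :=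
  ⟨ofCont p (analyticTrig A), ofCont_analyticTrig_mem p A⟩

theorem coeFn_polyHp (p : ℝ≥0∞) [Fact (1 ≤ p)] (A : ℂ[X]) :
    ((polyHp p A : LpT p) : AddCircle (1 : ℝ) → ℂ) =ᵐ[μT] fun t => A.eval (bdry t) := by
  filter_upwards [ContinuousMap.coeFn_toLp (p := p) (𝕜 := ℂ) μT (analyticTrig A)] with t ht
  rw [← analyticTrig_apply]
  exact ht

/-- An element of `H^p` is its own Riesz projection, and projections are limits of analytic
polynomials. -/
theorem denseRange_polyHp {p : ℝ≥0∞} [Fact (1 ≤ p)] (hp : 1 < p) (hp' : p ≠ ∞) :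
    DenseRange (polyHp p) := by
  intro g
  obtain ⟨h, A, hh, hA⟩ := exists_rieszProj_tendsto hp hp' (g : LpT p)
  have hgh : (g : LpT p) = h := sub_eq_zero.1
    (eq_zero_of_mem_Hp_of_mem_Kp hp ((Hp p).sub_mem g.2 h.2) hh)
  rw [← hgh] at hA
  exact mem_closure_of_tendsto (tendsto_subtype_rng.2 hA)
    (Eventually.of_forall fun n => Set.mem_range_self (A n))

/-! ### Rational functions: evaluation, factorization, partial fractions. -/

theorem ae_eval_bdry_ne {Q : ℂ[X]} (hQ : Q ≠ 0) : ∀ᵐ t ∂μT, Q.eval (bdry t) ≠ 0 := by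
  have hinj : Function.Injective bdry := fun s t h =>
    AddCircle.injective_toCircle one_ne_zero (Subtype.ext h)
  rw [ae_iff]
  refine μT_finite (((Q.roots.toFinset.finite_toSet).preimage hinj.injOn).subset fun t ht => ?_)
  simpa [hQ] using ht

theorem ratEval_eq (ω : RatFunc ℂ) (z : ℂ) : ratEval ω z = ω.num.eval z / ω.denom.eval z := by
  rw [ratEval, RatFunc.eval, eval₂_id, eval₂_id]

theorem num_mul_eq_mul_denom (r : ℂ[X]) {b : ℂ[X]} (hb : b ≠ 0) :
    (algebraMap ℂ[X] (RatFunc ℂ) r / algebraMap ℂ[X] (RatFunc ℂ) b).num * b =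
      r * (algebraMap ℂ[X] (RatFunc ℂ) r / algebraMap ℂ[X] (RatFunc ℂ) b).denom := by
  have h := RatFunc.num_div_denom (algebraMap ℂ[X] (RatFunc ℂ) r / algebraMap ℂ[X] (RatFunc ℂ) b)
  rw [div_eq_div_iff (RatFunc.algebraMap_ne_zero (RatFunc.denom_ne_zero _))
    (RatFunc.algebraMap_ne_zero hb), ← map_mul, ← map_mul] at h
  exact RatFunc.algebraMap_injective ℂ h

theorem ratEval_div (r : ℂ[X]) {b : ℂ[X]} {z : ℂ} (hb : b.eval z ≠ 0) :
    ratEval (algebraMap ℂ[X] (RatFunc ℂ) r / algebraMap ℂ[X] (RatFunc ℂ) b) z =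
      r.eval z / b.eval z := by
  have hb0 : b ≠ 0 := by
    rintro rfl
    simp at hb
  set ρ := algebraMap ℂ[X] (RatFunc ℂ) r / algebraMap ℂ[X] (RatFunc ℂ) b with hρ
  have h : ρ.num * b = r * ρ.denom := num_mul_eq_mul_denom r hb0
  have hd : ρ.denom.eval z ≠ 0 := fun h0 =>
    hb (eval_eq_zero_of_dvd_of_eval_eq_zero (RatFunc.denom_div_dvd r b) h0)
  rw [ratEval_eq, div_eq_div_iff hd hb, ← eval_mul, ← eval_mul, h]

theorem div_mem_Rat0T {r b : ℂ[X]} (hr : r.degree < b.degree) (hb : ∀ z ∈ b.roots, ‖z‖ = 1) :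
    algebraMap ℂ[X] (RatFunc ℂ) r / algebraMap ℂ[X] (RatFunc ℂ) b ∈ Rat0T := by
  have hb0 : b ≠ 0 := by
    rintro rfl
    simp at hr
  set ρ := algebraMap ℂ[X] (RatFunc ℂ) r / algebraMap ℂ[X] (RatFunc ℂ) b with hρ
  have h : ρ.num * b = r * ρ.denom := num_mul_eq_mul_denom r hb0
  refine ⟨?_, fun z hz => hb z ((mem_roots hb0).2 (hz.dvd (RatFunc.denom_div_dvd r b)))⟩
  by_contra hc
  push Not at hc
  have h1 := congrArg degree h
  rw [degree_mul, degree_mul] at h1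
  have h2 : r.degree + ρ.denom.degree < b.degree + ρ.denom.degree :=
    WithBot.add_lt_add_right (by simp [RatFunc.denom_ne_zero]) hr
  rw [← h1, add_comm] at h2
  exact absurd (add_le_add_right hc _) (not_le.mpr h2)

theorem exists_factorization {Q : ℂ[X]} (hQ : Q.Monic) (P : ℂ → Prop) :
    ∃ a b : ℂ[X], a.Monic ∧ b.Monic ∧ Q = a * b ∧ (∀ z ∈ a.roots, P z) ∧
      ∀ z ∈ b.roots, ¬ P z := by
  classical
  refine ⟨((Q.roots.filter P).map fun a => X - C a).prod,
    ((Q.roots.filter fun z => ¬ P z).map fun a => X - C a).prod,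
    monic_multiset_prod_of_monic _ _ fun a _ => monic_X_sub_C a,
    monic_multiset_prod_of_monic _ _ fun a _ => monic_X_sub_C a, ?_, ?_, ?_⟩
  · rw [← Multiset.prod_add, ← Multiset.map_add, Multiset.filter_add_not]
    exact monic_eq_prod_roots hQ
  · rw [roots_multiset_prod_X_sub_C]
    exact fun z hz => (Multiset.mem_filter.1 hz).2
  · rw [roots_multiset_prod_X_sub_C]
    exact fun z hz => (Multiset.mem_filter.1 hz).2

theorem isCoprime_of_disjoint_roots {a b : ℂ[X]} (ha : a ≠ 0) (hb : b ≠ 0)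
    (h : ∀ z ∈ a.roots, z ∉ b.roots) : IsCoprime a b := by
  rw [Polynomial.isCoprime_iff_aeval_ne_zero_of_isAlgClosed ℂ ℂ]
  intro z
  by_contra hc
  push Not at hc
  simp only [coe_aeval_eq_eval] at hc
  exact h z ((mem_roots ha).2 hc.1) ((mem_roots hb).2 hc.2)

/-- Partial fractions `R/(ab) = A/a + B/b` with `A/a` strictly proper: a Bézout relation, followed
by reduction modulo `a`. -/
theorem exists_mul_add_mul {a b : ℂ[X]} (ha : a.Monic) (hab : IsCoprime a b) (R : ℂ[X]) :
    ∃ A B : ℂ[X], R = A * b + B * a ∧ A.degree < a.degree := by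
  obtain ⟨x, y, hxy⟩ := hab
  refine ⟨(R * y) %ₘ a, R * x + (R * y) /ₘ a * b, ?_, degree_modByMonic_lt _ ha⟩
  have h := modByMonic_add_div (R * y) a
  linear_combination (-R) * hxy - b * h

theorem continuous_eval_div {N Q : ℂ[X]} (hQ : Q ≠ 0) (h : ∀ z ∈ Q.roots, ‖z‖ ≠ 1) :
    Continuous fun t => N.eval (bdry t) / Q.eval (bdry t) :=
  (continuous_eval_bdry N).div (continuous_eval_bdry Q) fun t ht =>
    h _ ((mem_roots hQ).2 ht) (norm_bdry t)

theorem eval_bdry_ne {Q : ℂ[X]} (hQ : Q ≠ 0) (h : ∀ z ∈ Q.roots, ‖z‖ ≠ 1)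
    (t : AddCircle (1 : ℝ)) : Q.eval (bdry t) ≠ 0 := fun ht =>
  h _ ((mem_roots hQ).2 ht) (norm_bdry t)

/-! ### The graph of `T_ω` described by Fourier coefficients. -/

/-- `ω.denom = d * e` with the zeros of `d` outside and those of `e` in the closed unit disc. -/
structure DenomFactorization (ω : RatFunc ℂ) (d e : ℂ[X]) : Prop where
  denom_eq : ω.denom = d * e
  monic_left : d.Monic
  monic_right : e.Monic
  one_lt : ∀ z ∈ d.roots, 1 < ‖z‖
  le_one : ∀ z ∈ e.roots, ‖z‖ ≤ 1

theorem exists_denomFactorization (ω : RatFunc ℂ) : ∃ d e, DenomFactorization ω d e := by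
  obtain ⟨d, e, hd, he, h, h1, h2⟩ := exists_factorization (RatFunc.monic_denom ω) fun z => 1 < ‖z‖
  exact ⟨d, e, h, hd, he, h1, fun z hz => not_lt.1 (h2 z hz)⟩

/-- The function `(s / d) g - e h`, where `ω = s / (d e)`. -/
def residual (ω : RatFunc ℂ) (d e : ℂ[X]) (g h : AddCircle (1 : ℝ) → ℂ) :
    AddCircle (1 : ℝ) → ℂ :=
  fun t => ω.num.eval (bdry t) / d.eval (bdry t) * g t - e.eval (bdry t) * h t

namespace DenomFactorization

variable {ω : RatFunc ℂ} {d e : ℂ[X]} {p : ℝ≥0∞}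

theorem isCoprime (H : DenomFactorization ω d e) : IsCoprime d e :=
  isCoprime_of_disjoint_roots H.monic_left.ne_zero H.monic_right.ne_zero fun z hz hz' =>
    (H.one_lt z hz).not_ge (H.le_one z hz')

theorem eval_left_ne (H : DenomFactorization ω d e) (t : AddCircle (1 : ℝ)) :
    d.eval (bdry t) ≠ 0 :=
  eval_bdry_ne H.monic_left.ne_zero (fun z hz => (H.one_lt z hz).ne') t

theorem continuous_symbol (H : DenomFactorization ω d e) (N : ℂ[X]) :
    Continuous fun t => N.eval (bdry t) / d.eval (bdry t) :=
  continuous_eval_div H.monic_left.ne_zero fun z hz => (H.one_lt z hz).ne'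

theorem memLp_residual (H : DenomFactorization ω d e) {g h : AddCircle (1 : ℝ) → ℂ}
    (hg : MemLp g p μT) (hh : MemLp h p μT) : MemLp (residual ω d e g h) p μT :=
  (memLp_mul_continuous (H.continuous_symbol _) hg).sub
    (memLp_mul_continuous (continuous_eval_bdry e) hh)

variable [Fact (1 ≤ p)]

/-- Multiplication by `d` gives `s g - d e h`, which has no negative frequencies; dividing by `d`
again is harmless since its zeros lie outside the disc. -/
theorem fourierCoeff_residual_of_neg (H : DenomFactorization ω d e) (g h : Hp p) :
    ∀ j < 0, fourierCoeff (residual ω d e (g : LpT p) (h : LpT p)) j = 0 := by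
  have hw := H.memLp_residual (Lp.memLp (g : LpT p)) (Lp.memLp (h : LpT p))
  refine fourierCoeff_eq_zero_of_lt_of_eval_mul H.monic_left (fun z hz => (H.one_lt z hz).le)
    (hw.integrable Fact.out) fun j hj => ?_
  have h1 : (fun t => d.eval (bdry t) * residual ω d e (g : LpT p) (h : LpT p) t) = fun t =>
      ω.num.eval (bdry t) * (g : LpT p) t - (d * e).eval (bdry t) * (h : LpT p) t := by
    ext t
    have := H.eval_left_ne t
    rw [residual, eval_mul]
    field_simp
  rw [h1, fourierCoeff_sub (integrable_mul_continuous (continuous_eval_bdry _) (integrable_LpT _))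
    (integrable_mul_continuous (continuous_eval_bdry _) (integrable_LpT _)),
    fourierCoeff_eval_mul_of_lt (integrable_LpT _) g.2 hj,
    fourierCoeff_eval_mul_of_lt (integrable_LpT _) h.2 hj, sub_zero]

/-- With `k = f - h ∈ K^p` and `ρ = r/b`, the residual `w` satisfies `b w = e (b k + r)`. The right
side has no frequencies from `deg b + deg e` on, and the zeros of `b` lie on the circle. -/
theorem fourierCoeff_residual_of_mem_graph (H : DenomFactorization ω d e) {g h : Hp p}
    (hgh : (g, h) ∈ toeplitzGraph p ω) (j : ℤ) (hj : (e.natDegree : ℤ) ≤ j) :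
    fourierCoeff (residual ω d e (g : LpT p) (h : LpT p)) j = 0 := by
  obtain ⟨f, ρ, ⟨⟨hρ1, hρ2⟩, hae⟩, hk⟩ := hgh
  have hw := H.memLp_residual (Lp.memLp (g : LpT p)) (Lp.memLp (h : LpT p))
  have hb : ρ.denom.Monic := RatFunc.monic_denom ρ
  refine fourierCoeff_eq_zero_of_ge_of_eval_mul hb
    (fun z hz => (hρ2 z (isRoot_of_mem_roots hz)).le) (hw.integrable Fact.out) (fun j hj => ?_) j hj
  set k : LpT p := f - (h : LpT p) with hkdef
  have hi : Integrable (fun t => ρ.denom.eval (bdry t) * k t) μT :=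
    integrable_mul_continuous (continuous_eval_bdry _) (integrable_LpT _)
  have hr : Integrable (fun t => ρ.num.eval (bdry t)) μT :=
    (memLp_continuous (p := 1) (continuous_eval_bdry _)).integrable le_rfl
  have h1 : (fun t => ρ.denom.eval (bdry t) * residual ω d e (g : LpT p) (h : LpT p) t) =ᵐ[μT]
      fun t => e.eval (bdry t) * (ρ.denom.eval (bdry t) * k t + ρ.num.eval (bdry t)) := by
    filter_upwards [hae, Lp.coeFn_sub f (h : LpT p), ae_eval_bdry_ne hb.ne_zero,
      ae_eval_bdry_ne H.monic_right.ne_zero] with t h1 h2 h3 h4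
    have h5 := H.eval_left_ne t
    rw [hkdef, h2, Pi.sub_apply, residual]
    rw [ratEval_eq, ratEval_eq, H.denom_eq, eval_mul] at h1
    field_simp at h1 ⊢
    linear_combination h1
  rw [fourierCoeff_congr_ae h1]
  refine fourierCoeff_eval_mul_of_ge (hi.add hr) (m := ρ.denom.natDegree) (fun i hi' => ?_)
    (by omega)
  rw [fourierCoeff.add hi hr, Pi.add_apply,
    fourierCoeff_eval_mul_of_ge (integrable_LpT k) hk (by omega),
    fourierCoeff_eval_of_degree_lt (hρ1.trans_le degree_le_natDegree) hi', add_zero]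

/-- The residual is a polynomial `v` with `deg v < deg e`. Splitting `e = ab` into zeros inside and
zeros on the circle, `v/e = A/a + R/b` gives `ωg = h + A/a + R/b` with `A/a ∈ K^p` and `R/b` in
`Rat0T`. -/
theorem mem_graph_of_fourierCoeff_residual (H : DenomFactorization ω d e) (hp : 1 < p) {g h : Hp p}
    (hgh : ∀ j : ℤ, e.natDegree ≤ j →
      fourierCoeff (residual ω d e (g : LpT p) (h : LpT p)) j = 0) :
    (g, h) ∈ toeplitzGraph p ω := by
  have hw := H.memLp_residual (Lp.memLp (g : LpT p)) (Lp.memLp (h : LpT p))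
  obtain ⟨v, hv, hwv⟩ := exists_polynomial_of_fourierCoeff hp hw
    (H.fourierCoeff_residual_of_neg g h) hgh
  obtain ⟨a, b, ha, hb, hab, hra, hrb⟩ := exists_factorization H.monic_right fun z => ‖z‖ < 1
  have hra' : ∀ z ∈ a.roots, ‖z‖ ≠ 1 := fun z hz => (hra z hz).ne
  have hrb' : ∀ z ∈ b.roots, ‖z‖ = 1 := fun z hz => le_antisymm
    (H.le_one z (by
      rw [hab, mem_roots (ha.mul hb).ne_zero]
      exact (isRoot_of_mem_roots hz).dvd (dvd_mul_left b a)))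
    (not_lt.1 (hrb z hz))
  obtain ⟨A, R, hvAR, hA⟩ := exists_mul_add_mul ha (isCoprime_of_disjoint_roots ha.ne_zero
    hb.ne_zero fun z hz hz' => hrb z hz' (hra z hz)) v
  have hR : R.degree < b.degree := by
    rw [← degree_eq_natDegree H.monic_right.ne_zero, hab, degree_mul] at hv
    have h1 : (R * a).degree < a.degree + b.degree := by
      rw [show R * a = v - A * b by rw [hvAR]; ring]
      refine (degree_sub_le _ _).trans_lt (max_lt hv ?_)
      rw [degree_mul]
      exact WithBot.add_lt_add_right (degree_ne_bot.2 hb.ne_zero) hA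
    rw [degree_mul, add_comm] at h1
    exact lt_of_add_lt_add_left h1
  have hkL : MemLp (fun t => A.eval (bdry t) / a.eval (bdry t)) p μT :=
    memLp_continuous (continuous_eval_div ha.ne_zero hra')
  have hk : hkL.toLp ∈ Kp p := by
    intro j hj
    rw [fourierCoeff_congr_ae hkL.coeFn_toLp]
    refine fourierCoeff_eq_zero_of_ge_of_eval_mul ha (fun z hz => (hra z hz).le)
      (hkL.integrable Fact.out) (fun j hj => ?_) j hj
    have h1 : (fun t => a.eval (bdry t) * (A.eval (bdry t) / a.eval (bdry t))) =
        fun t => A.eval (bdry t) := by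
      ext t
      rw [mul_div_cancel₀ _ (eval_bdry_ne ha.ne_zero hra' t)]
    rw [h1]
    exact fourierCoeff_eval_of_degree_lt (hA.trans_le degree_le_natDegree) (by omega)
  refine ⟨(h : LpT p) + hkL.toLp, algebraMap ℂ[X] (RatFunc ℂ) R / algebraMap ℂ[X] (RatFunc ℂ) b,
    ⟨div_mem_Rat0T hR hrb', ?_⟩, ?_⟩
  · filter_upwards [hwv, Lp.coeFn_add (h : LpT p) hkL.toLp, hkL.coeFn_toLp,
      ae_eval_bdry_ne hb.ne_zero] with t h1 h2 h3 h4
    have h5 := H.eval_left_ne t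
    have h6 := eval_bdry_ne ha.ne_zero hra' t
    rw [ratEval_div R h4, h2, Pi.add_apply, h3, ratEval_eq, H.denom_eq, hab]
    rw [residual, hvAR, hab] at h1
    simp only [eval_mul, eval_add] at h1 ⊢
    field_simp at h1 ⊢
    linear_combination h1
  · rw [IsRieszProj, add_sub_cancel_left]
    exact hk

theorem mem_graph_iff (H : DenomFactorization ω d e) (hp : 1 < p) (g h : Hp p) :
    (g, h) ∈ toeplitzGraph p ω ↔ ∀ j : ℤ, e.natDegree ≤ j →
      fourierCoeff (residual ω d e (g : LpT p) (h : LpT p)) j = 0 :=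
  ⟨H.fourierCoeff_residual_of_mem_graph, H.mem_graph_of_fourierCoeff_residual hp⟩

end DenomFactorization

/-! ### Closedness, well-definedness and domain of `T_ω`. -/

variable {p : ℝ≥0∞} [Fact (1 ≤ p)]

theorem isClosed_toeplitzGraph (hp : 1 < p) (ω : RatFunc ℂ) :
    IsClosed (toeplitzGraph p ω : Set (Hp p × Hp p)) := by
  obtain ⟨d, e, H⟩ := exists_denomFactorization ω
  let c : C(AddCircle (1 : ℝ), ℂ) := ⟨_, H.continuous_symbol ω.num⟩
  have hset : (toeplitzGraph p ω : Set (Hp p × Hp p)) =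
      ⋂ j : ℤ, ⋂ _ : (e.natDegree : ℤ) ≤ j,
        {x | pairing p (fourier (-j) * c) x.1 - pairing p (fourier (-j) * analyticTrig e) x.2 = 0} := by
    ext ⟨g, h⟩
    simp only [SetLike.mem_coe, H.mem_graph_iff hp, Set.mem_iInter, Set.mem_ofPred_eq]
    refine forall₂_congr fun j _ => ?_
    have h1 : fourierCoeff (residual ω d e (g : LpT p) (h : LpT p)) j =
        pairing p (fourier (-j) * c) g - pairing p (fourier (-j) * analyticTrig e) h := by
      rw [pairing_apply, pairing_apply, ← integral_sub
        (integrable_mul_continuous (ContinuousMap.continuous _) (integrable_LpT _))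
        (integrable_mul_continuous (ContinuousMap.continuous _) (integrable_LpT _))]
      refine integral_congr_ae (Eventually.of_forall fun t => ?_)
      simp only [residual, ContinuousMap.mul_apply, analyticTrig_apply, smul_eq_mul, c,
        ContinuousMap.coe_mk]
      ring
    rw [h1]
  rw [hset]
  refine isClosed_iInter fun j => isClosed_iInter fun _ => isClosed_eq ?_ continuous_const
  exact ((pairing p _).continuous.comp (continuous_subtype_val.comp continuous_fst)).sub
    ((pairing p _).continuous.comp (continuous_subtype_val.comp continuous_snd))

/-- For `g = 0` the residual is `-e h`; dividing by `e` puts `h` in `K^p` as well as in `H^p`. -/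
theorem eq_zero_of_zero_mem_toeplitzGraph (hp : 1 < p) {ω : RatFunc ℂ} {h : Hp p}
    (hh : ((0 : Hp p), h) ∈ toeplitzGraph p ω) : h = 0 := by
  obtain ⟨d, e, H⟩ := exists_denomFactorization ω
  have h1 := (H.mem_graph_iff hp 0 h).1 hh
  refine Subtype.ext (eq_zero_of_mem_Hp_of_mem_Kp hp h.2 ?_)
  refine fourierCoeff_eq_zero_of_ge_of_eval_mul H.monic_right H.le_one (integrable_LpT _)
    fun j hj => ?_
  have h2 : residual ω d e ((0 : Hp p) : LpT p) (h : LpT p) =ᵐ[μT]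
      fun t => -1 * (e.eval (bdry t) * (h : LpT p) t) := by
    filter_upwards [Lp.coeFn_zero ℂ p μT] with t ht
    rw [residual, ZeroMemClass.coe_zero, ht]
    simp
  have h3 := h1 j (by omega)
  rw [fourierCoeff_congr_ae h2, fourierCoeff.const_mul] at h3
  simpa using h3

theorem toeplitz_graph (hp : 1 < p) (ω : RatFunc ℂ) :
    (toeplitz p ω).graph = toeplitzGraph p ω :=
  Submodule.toLinearPMap_graph_eq _ <| by
    rintro ⟨g, h⟩ hx (rfl : g = 0)
    exact eq_zero_of_zero_mem_toeplitzGraph hp hx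

theorem mem_toeplitzGraph_iff (hp : 1 < p) {ω : RatFunc ℂ} {g h : Hp p} :
    (g, h) ∈ toeplitzGraph p ω ↔
      ∃ hg : g ∈ (toeplitz p ω).domain, toeplitz p ω ⟨g, hg⟩ = h := by
  rw [← toeplitz_graph hp, LinearPMap.mem_graph_iff]
  constructor
  · rintro ⟨⟨y, hy⟩, rfl, h2⟩
    exact ⟨hy, h2⟩
  · rintro ⟨hg, h2⟩
    exact ⟨⟨g, hg⟩, rfl, h2⟩

/-- The graph asks for a Riesz projection of `f` besides the decomposition; by M. Riesz it always
exists. -/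
theorem mem_toeplitz_domain_iff (hp : 1 < p) (hp' : p ≠ ∞) (ω : RatFunc ℂ) (g : Hp p) :
    g ∈ (toeplitz p ω).domain ↔ ∃ (f : LpT p) (ρ : RatFunc ℂ), Decomp ω g f ρ := by
  constructor
  · intro hg
    obtain ⟨f, ρ, h, -⟩ := (mem_toeplitzGraph_iff hp).2 ⟨hg, rfl⟩
    exact ⟨f, ρ, h⟩
  · rintro ⟨f, ρ, h⟩
    obtain ⟨k, hk⟩ := exists_isRieszProj hp hp' f
    exact ((mem_toeplitzGraph_iff hp).1 ⟨f, ρ, h, hk⟩).1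

theorem isRieszProj_iff_eq_toeplitz (hp : 1 < p) (hp' : p ≠ ∞) {ω : RatFunc ℂ}
    (g : (toeplitz p ω).domain) {f : LpT p} {ρ : RatFunc ℂ} (hd : Decomp ω (g : Hp p) f ρ)
    (h : Hp p) : IsRieszProj f h ↔ h = toeplitz p ω g := by
  have key : ∀ k : Hp p, IsRieszProj f k → k = toeplitz p ω g := fun k hk =>
    ((mem_toeplitzGraph_iff hp).1 ⟨f, ρ, hd, hk⟩).2.symm
  refine ⟨key h, ?_⟩
  rintro rfl
  obtain ⟨k, hk⟩ := exists_isRieszProj hp hp' f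
  rwa [← key k hk]

/-- Write `s P = v d + A e` with `deg v < deg e`. Then `h = A/d` lies in `H^p`, and the residual of
`(P, h)` is `v`. -/
theorem polyHp_mem_toeplitz_domain (hp : 1 < p) (ω : RatFunc ℂ) (P : ℂ[X]) :
    polyHp p P ∈ (toeplitz p ω).domain := by
  obtain ⟨d, e, H⟩ := exists_denomFactorization ω
  obtain ⟨v, A, hsP, hv⟩ := exists_mul_add_mul H.monic_right H.isCoprime.symm (ω.num * P)
  have hL : MemLp (fun t => A.eval (bdry t) / d.eval (bdry t)) p μT :=
    memLp_continuous (H.continuous_symbol A)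
  have hH : hL.toLp ∈ Hp p := by
    intro j hj
    rw [fourierCoeff_congr_ae hL.coeFn_toLp]
    refine fourierCoeff_eq_zero_of_lt_of_eval_mul H.monic_left (fun z hz => (H.one_lt z hz).le)
      (hL.integrable Fact.out) (fun j hj => ?_) j hj
    have h1 : (fun t => d.eval (bdry t) * (A.eval (bdry t) / d.eval (bdry t))) =
        fun t => A.eval (bdry t) := by
      ext t
      rw [mul_div_cancel₀ _ (H.eval_left_ne t)]
    rw [h1, fourierCoeff_eval, if_neg (by omega)]
  have hg : (polyHp p P, (⟨hL.toLp, hH⟩ : Hp p)) ∈ toeplitzGraph p ω := by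
    refine (H.mem_graph_iff hp _ _).2 fun j hj => ?_
    rw [← fourierCoeff_eval_of_degree_lt (hv.trans_le degree_le_natDegree) hj]
    refine congrFun (fourierCoeff_congr_ae ?_) j
    filter_upwards [coeFn_polyHp p P, hL.coeFn_toLp] with t h1 h2
    have h3 := H.eval_left_ne t
    have h4 := congrArg (eval (bdry t)) hsP
    rw [residual, h1, h2]
    simp only [eval_mul, eval_add] at h4
    field_simp
    linear_combination h4
  exact ((mem_toeplitzGraph_iff hp).1 hg).1

theorem dense_toeplitz_domain (hp : 1 < p) (hp' : p ≠ ∞) (ω : RatFunc ℂ) :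
    Dense ((toeplitz p ω).domain : Set (Hp p)) := by
  refine (denseRange_polyHp hp hp').mono ?_
  rintro _ ⟨P, rfl⟩
  exact polyHp_mem_toeplitz_domain hp ω P

/-! ### The forward shift and the symbol `z⁻¹`. -/

theorem coeFn_shift (g : Hp p) :
    ((shift p g : LpT p) : AddCircle (1 : ℝ) → ℂ) =ᵐ[μT] fun t => bdry t * (g : LpT p) t :=
  MemLp.coeFn_toLp (bdry_mul_memLp (g : LpT p))

theorem coeFn_shift_add_const (g : Hp p) (c : ℂ) :
    ((shift p g + polyHp p (C c) : Hp p) : LpT p) =ᵐ[μT]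
      fun t => bdry t * (g : LpT p) t + c := by
  filter_upwards [coeFn_shift g, coeFn_polyHp p (C c),
    Lp.coeFn_add (shift p g : LpT p) (polyHp p (C c) : LpT p)] with t h1 h2 h3
  rw [Submodule.coe_add, h3, Pi.add_apply, h1, h2, eval_C]

theorem exists_shift_mem_toeplitzGraph (hp : 1 < p) {ω : RatFunc ℂ} {g h : Hp p}
    (hgh : (g, h) ∈ toeplitzGraph p ω) :
    ∃ c : ℂ, (shift p g, shift p h + polyHp p (C c)) ∈ toeplitzGraph p ω := by
  obtain ⟨d, e, H⟩ := exists_denomFactorization ω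
  rw [H.mem_graph_iff hp] at hgh
  set w := residual ω d e (g : LpT p) (h : LpT p) with hw
  have hwi : Integrable w μT :=
    (H.memLp_residual (Lp.memLp (g : LpT p)) (Lp.memLp (h : LpT p))).integrable Fact.out
  -- The new residual `zw - ce` can fail the criterion only at index `deg e`, where, `e` being
  -- monic, its coefficient is `ŵ(deg e - 1) - c`. The subtraction is in `ℤ`, so the index is `-1`
  -- when `e = 1`.
  refine ⟨fourierCoeff w (e.natDegree - 1), (H.mem_graph_iff hp _ _).2 fun j hj => ?_⟩
  set c := fourierCoeff w (e.natDegree - 1) with hc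
  have h1 : residual ω d e (shift p g : LpT p) ((shift p h + polyHp p (C c) : Hp p) : LpT p)
      =ᵐ[μT] fun t => bdry t * w t - c * e.eval (bdry t) := by
    filter_upwards [coeFn_shift g, coeFn_shift_add_const h c] with t h1 h2
    rw [residual, h1, h2, hw, residual]
    ring
  rw [fourierCoeff_congr_ae h1, fourierCoeff_sub (integrable_mul_continuous continuous_bdry hwi)
    (((memLp_continuous (p := 1) (continuous_eval_bdry e)).integrable le_rfl).const_mul c),
    fourierCoeff_bdry_mul, fourierCoeff.const_mul]
  rcases hj.eq_or_lt with rfl | hlt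
  · rw [fourierCoeff_eval, if_pos (by omega), Int.toNat_natCast,
      show e.coeff e.natDegree = 1 from H.monic_right, mul_one, ← hc, sub_self]
  · rw [hgh (j - 1) (by omega), fourierCoeff_eval_of_degree_lt (m := e.natDegree + 1)
      (degree_le_natDegree.trans_lt (by exact_mod_cast Nat.lt_succ_self _))
      (by push_cast; omega), mul_zero, sub_zero]

theorem denom_X_inv : (RatFunc.X : RatFunc ℂ)⁻¹.denom = X :=
  eq_of_monic_of_associated (RatFunc.monic_denom _) monic_X
    (by simpa using RatFunc.associated_denom_inv (RatFunc.X_ne_zero (K := ℂ)))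

theorem num_X_inv : (RatFunc.X : RatFunc ℂ)⁻¹.num = 1 := by
  have h := num_mul_eq_mul_denom 1 (X_ne_zero (R := ℂ))
  rw [map_one, RatFunc.algebraMap_X, one_div, denom_X_inv] at h
  exact mul_right_cancel₀ X_ne_zero h

theorem denomFactorization_X_inv : DenomFactorization (RatFunc.X : RatFunc ℂ)⁻¹ 1 X where
  denom_eq := by rw [one_mul, denom_X_inv]
  monic_left := monic_one
  monic_right := monic_X
  one_lt := by simp
  le_one := by simp

/-- For the symbol `z⁻¹`, with `d = 1` and `e = X`, the residual is `(zh + c) - zh = c`, of degree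
below one. -/
theorem shift_add_const_mem_toeplitzGraph (hp : 1 < p) (h : Hp p) (c : ℂ) :
    (shift p h + polyHp p (C c), h) ∈ toeplitzGraph p (RatFunc.X : RatFunc ℂ)⁻¹ := by
  refine (denomFactorization_X_inv.mem_graph_iff hp _ _).2 fun j hj => ?_
  rw [← fourierCoeff_eval_of_degree_lt (degree_C_le.trans_lt (zero_lt_one) : (C c).degree < (1 : ℕ))
    (by simpa using hj)]
  refine congrFun (fourierCoeff_congr_ae ?_) j
  filter_upwards [coeFn_shift_add_const h c] with t h1
  rw [residual, h1, num_X_inv]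
  simp

end ToeplitzLike

end

open ToeplitzLike
theorem propositionP (p : ℝ≥0∞) [Fact (1 ≤ p)] (hp : 1 < p) (hp' : p < ∞) (ω : RatFunc ℂ) :
    -- the domain of `T_ω` is the set of all `g` in `H^p` with `ω g ∈ L^p + Rat₀(𝕋)`
    (∀ g : Hp p, g ∈ (toeplitz p ω).domain ↔
      ∃ (f : LpT p) (ρ : RatFunc ℂ), Decomp ω g f ρ) ∧
    -- `T_ω` is well defined: for every choice of `f` and `ρ`, `ℙ f` exists, is unique and is `T_ω g`
    (∀ (g : (toeplitz p ω).domain) (f : LpT p) (ρ : RatFunc ℂ),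
      Decomp ω (g : Hp p) f ρ →
        ∀ h : Hp p,
          IsRieszProj f h ↔ h = toeplitz p ω g) ∧
    -- `T_ω` is closed and densely defined
    (toeplitz p ω).IsClosed ∧
    Dense ((toeplitz p ω).domain : Set (Hp p)) ∧
    -- all polynomials are in the domain
    (∀ P : Polynomial ℂ, ∃ g ∈ (toeplitz p ω).domain,
      ∀ᵐ t ∂μT, (g : LpT p) t = P.eval (bdry t)) ∧
    -- the domain is invariant under `T_z`, and `T_{z⁻¹} T_ω T_z g = T_ω g` for `g` in it
    (∀ g : (toeplitz p ω).domain,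
      ∃ (h₁ : shift p g ∈ (toeplitz p ω).domain)
        (h₂ : toeplitz p ω ⟨shift p g, h₁⟩ ∈
          (toeplitz p (RatFunc.X)⁻¹).domain),
        toeplitz p (RatFunc.X)⁻¹
          ⟨toeplitz p ω ⟨shift p g, h₁⟩, h₂⟩ =
            toeplitz p ω g) := by
  refine ⟨mem_toeplitz_domain_iff hp hp'.ne ω,
    fun g f ρ hd h => isRieszProj_iff_eq_toeplitz hp hp'.ne g hd h, ?_,
    dense_toeplitz_domain hp hp'.ne ω,
    fun P => ⟨polyHp p P, polyHp_mem_toeplitz_domain hp ω P, coeFn_polyHp p P⟩, fun g => ?_⟩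
  · rw [LinearPMap.IsClosed, toeplitz_graph hp]
    exact isClosed_toeplitzGraph hp ω
  · obtain ⟨c, hc⟩ := exists_shift_mem_toeplitzGraph hp
      ((mem_toeplitzGraph_iff hp).2 ⟨g.2, rfl⟩)
    obtain ⟨h₁, h₂⟩ := (mem_toeplitzGraph_iff hp).1 hc
    obtain ⟨h₃, h₄⟩ := (mem_toeplitzGraph_iff hp).1
      (shift_add_const_mem_toeplitzGraph hp (toeplitz p ω g) c)
    refine ⟨h₁, h₂ ▸ h₃, Eq.trans ?_ h₄⟩
    congr 1
    exact Subtype.ext h₂
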